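/- Let $\Gamma$ be a compact metric graph with finite vertex set $\mathcal V$ and finite non-empty edge set $\mathcal E$ (loops and multiple edges are allowed), each edge $e$ being identified with an interval $[0,\ell_e]$, $\ell_e>0$. Let $\mathcal V_R\subset\mathcal V$, and for $\sigma\ge 0$ let $H^{(\sigma)}$ be the operator in $L^2(\Gamma)=\bigoplus_{e}L^2([0,\ell_e])$ that acts as $-\frac{d^2}{dx^2}$ on every edge, with domain the functions $f$ that are of class $W^{2,2}$ on each edge, are continuous at all vertices, and satisfy \[ \sum_{e\in\mathcal E_v} f'|_e(v)=\sigma f(v)\quad (v\in\mathcal V_R),\qquad \sum_{e\in\mathcal E_v} f'|_e(v)=0\quad (v\in\mathcal V\setminus\mathcal V_R), \] where the sums are over the edge ends at $v$ and the derivatives are taken in the direction pointing from $v$ into the edge. For each $\sigma\ge0$ the eigenvalues of $H^{(\sigma)}$, repeated according to their (finite) multiplicities, form a nondecreasing sequence of real numbers $\lambda_1(\sigma)\le\lambda_2(\sigma)\le\dots\nearrow\infty$. Let \[ d_n(\sigma):=\lambda_n(\sigma)-\lambda_n(0),\qquad n\ge 1,\ \sigma\ge 0, \] be the Robin-Neumann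 gaps. Then the functions $d_n$ are Lipschitz continuous on $[0,\infty)$ uniformly in $n$: there is $C\in\mathbb R$ (depending only on $\Gamma$ and $\mathcal V_R$) such that \[ |d_n(\sigma_1)-d_n(\sigma_2)|\le C\,|\sigma_1-\sigma_2|\qquad\text{for all } n\ge 1 \text{ and all } \sigma_1,\sigma_2\ge 0 . \] In particular, the sequence $(d_n)_{n\ge1}$ is uniformly bounded on every compact interval contained in $[0,\infty)$. -/

import Mathlib

open MeasureTheory Set Filter Topology
open scoped ContDiff

/-- A metric graph with vertex set `V` and edge set `E` (the theorem takes both finite).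
The edge `e` is the interval `[0, length e]`; its left end is glued to the vertex `src e` and its
right end to the vertex `tgt e`. Loops and multiple edges are allowed. -/
structure MetricGraph (V E : Type*) where
  src : E → V
  tgt : E → V
  length : E → ℝ
  length_pos : ∀ e, 0 < length e

/-- `g` is a weak derivative of `f` on the interval `(0, ℓ)`. -/
def HasWeakDeriv (ℓ : ℝ) (f g : ℝ → ℂ) : Prop :=
  ∀ φ : ℝ → ℝ, ContDiff ℝ ∞ φ → HasCompactSupport φ → tsupport φ ⊆ Ioo 0 ℓ →
    ∫ x in Icc 0 ℓ, deriv φ x • f x = - ∫ x in Icc 0 ℓ, φ x • g x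

/-- `u` is the continuous representative on `[0, ℓ]` of a function of the Sobolev space
`W^{2,2}(0, ℓ)`, `u'` is the continuous representative of its weak derivative, and `w` is its
second weak derivative, which is square integrable. -/
structure IsSobolevTwo (ℓ : ℝ) (u u' w : ℝ → ℂ) : Prop where
  cont : ContinuousOn u (Icc 0 ℓ)
  cont' : ContinuousOn u' (Icc 0 ℓ)
  memLp : MemLp w 2 (volume.restrict (Icc 0 ℓ))
  weak : HasWeakDeriv ℓ u u'
  weak' : HasWeakDeriv ℓ u' w

section WeakDerivative

variable {ℓ : ℝ}

theorem integrable_test_smul {φ : ℝ → ℝ} (hφ : Continuous φ) (hc : HasCompactSupport φ)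
    {f : ℝ → ℂ} (hf : IntegrableOn f (Icc 0 ℓ)) :
    IntegrableOn (fun x => φ x • f x) (Icc 0 ℓ) := by
  obtain ⟨C, hC⟩ := hc.exists_bound_of_continuous hφ
  exact Integrable.bdd_smul hf C hφ.aestronglyMeasurable (Eventually.of_forall hC)

theorem HasWeakDeriv.add {f g f₂ g₂ : ℝ → ℂ} (h : HasWeakDeriv ℓ f g) (h₂ : HasWeakDeriv ℓ f₂ g₂)
    (hf : IntegrableOn f (Icc 0 ℓ)) (hf₂ : IntegrableOn f₂ (Icc 0 ℓ))
    (hg : IntegrableOn g (Icc 0 ℓ)) (hg₂ : IntegrableOn g₂ (Icc 0 ℓ)) :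
    HasWeakDeriv ℓ (f + f₂) (g + g₂) := by
  intro φ hφ hc hs
  have hd : Continuous (deriv φ) := hφ.continuous_deriv (by simp)
  simp only [Pi.add_apply, smul_add]
  rw [integral_add (integrable_test_smul hd hc.deriv hf) (integrable_test_smul hd hc.deriv hf₂),
    integral_add (integrable_test_smul hφ.continuous hc hg)
      (integrable_test_smul hφ.continuous hc hg₂), h φ hφ hc hs, h₂ φ hφ hc hs]
  ring

theorem HasWeakDeriv.const_smul {f g : ℝ → ℂ} (c : ℂ) (h : HasWeakDeriv ℓ f g) :
    HasWeakDeriv ℓ (c • f) (c • g) := by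
  intro φ hφ hc hs
  simp only [Pi.smul_apply, smul_comm _ c, integral_smul, h φ hφ hc hs, smul_neg]

theorem HasWeakDeriv.congr {f g f₂ g₂ : ℝ → ℂ} (h : HasWeakDeriv ℓ f g)
    (hf : f =ᵐ[volume.restrict (Icc 0 ℓ)] f₂) (hg : g =ᵐ[volume.restrict (Icc 0 ℓ)] g₂) :
    HasWeakDeriv ℓ f₂ g₂ := by
  intro φ hφ hc hs
  have h1 : ∫ x in Icc 0 ℓ, deriv φ x • f₂ x = ∫ x in Icc 0 ℓ, deriv φ x • f x :=
    integral_congr_ae (hf.mono fun x hx => by simp [hx])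
  have h2 : ∫ x in Icc 0 ℓ, φ x • g₂ x = ∫ x in Icc 0 ℓ, φ x • g x :=
    integral_congr_ae (hg.mono fun x hx => by simp [hx])
  rw [h1, h2, h φ hφ hc hs]

theorem HasWeakDeriv.ae_eq_zero {f g : ℝ → ℂ} (h : HasWeakDeriv ℓ f g)
    (hf : f =ᵐ[volume.restrict (Icc 0 ℓ)] 0) (hg : IntegrableOn g (Icc 0 ℓ)) :
    g =ᵐ[volume.restrict (Icc 0 ℓ)] 0 := by
  have key := IsOpen.ae_eq_zero_of_integral_contDiff_smul_eq_zero (μ := volume) (f := g)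
    (isOpen_Ioo (a := (0 : ℝ)) (b := ℓ))
    (hg.mono_set Ioo_subset_Icc_self).locallyIntegrableOn ?_
  · rw [← Measure.restrict_congr_set (Ioo_ae_eq_Icc (μ := volume) (a := (0 : ℝ)) (b := ℓ))]
    exact (ae_restrict_iff' measurableSet_Ioo).2 key
  · intro φ hφ hc hs
    have h0 := (h.congr hf (Eventually.of_forall fun _ => rfl)) φ hφ hc hs
    simp only [Pi.zero_apply, smul_zero, integral_zero] at h0
    rw [← setIntegral_eq_integral_of_forall_compl_eq_zero (s := Icc 0 ℓ)]
    · rw [eq_comm, neg_eq_zero] at h0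
      exact h0
    · intro x hx
      have : x ∉ tsupport φ := fun hx' => hx (Ioo_subset_Icc_self (hs hx'))
      simp [image_eq_zero_of_notMem_tsupport this]

theorem IsSobolevTwo.integrable {u u' w : ℝ → ℂ} (h : IsSobolevTwo ℓ u u' w) :
    IntegrableOn w (Icc 0 ℓ) :=
  h.memLp.integrable (by norm_num)

theorem IsSobolevTwo.add {u u' w v v' z : ℝ → ℂ} (h : IsSobolevTwo ℓ u u' w)
    (k : IsSobolevTwo ℓ v v' z) : IsSobolevTwo ℓ (u + v) (u' + v') (w + z) where
  cont := h.cont.add k.cont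
  cont' := h.cont'.add k.cont'
  memLp := h.memLp.add k.memLp
  weak := h.weak.add k.weak h.cont.integrableOn_Icc k.cont.integrableOn_Icc
    h.cont'.integrableOn_Icc k.cont'.integrableOn_Icc
  weak' := h.weak'.add k.weak' h.cont'.integrableOn_Icc k.cont'.integrableOn_Icc
    h.integrable k.integrable

theorem IsSobolevTwo.const_smul {u u' w : ℝ → ℂ} (c : ℂ) (h : IsSobolevTwo ℓ u u' w) :
    IsSobolevTwo ℓ (c • u) (c • u') (c • w) where
  cont := h.cont.const_smul c
  cont' := h.cont'.const_smul c
  memLp := h.memLp.const_smul c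
  weak := h.weak.const_smul c
  weak' := h.weak'.const_smul c

theorem IsSobolevTwo.congr {u u' w z : ℝ → ℂ} (h : IsSobolevTwo ℓ u u' w)
    (hw : w =ᵐ[volume.restrict (Icc 0 ℓ)] z) : IsSobolevTwo ℓ u u' z where
  cont := h.cont
  cont' := h.cont'
  memLp := h.memLp.ae_eq hw
  weak := h.weak
  weak' := h.weak'.congr (Eventually.of_forall fun _ => rfl) hw

end WeakDerivative

noncomputable section

namespace MetricGraph

variable {V E : Type*}

/-- The Hilbert space `L²(Γ) = ⨁ₑ L²([0, ℓₑ])` of complex valued functions. -/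
abbrev L2 [Fintype E] (Γ : MetricGraph V E) : Type _ :=
  PiLp 2 fun e : E => Lp ℂ 2 (volume.restrict (Icc 0 (Γ.length e)))

variable [Fintype E] [DecidableEq V]

/-- The function `f ∈ L²(Γ)` has on every edge the `W^{2,2}` representative `u e`, with derivative
`u' e`; `g = -f''` on every edge; and `f` satisfies the vertex conditions with the value `c v` at
each vertex `v`: continuity at all vertices, the Robin condition with parameter `σ` at the vertices
of `R`, current conservation at all other vertices. The sum of the derivatives at a vertex is over
all the edge ends there, outward from the vertex: `u' e 0` at a left end and `-u' e ℓₑ` at a right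
end (so a loop contributes twice). -/
structure IsRobinPair (Γ : MetricGraph V E) (R : Finset V) (σ : ℝ) (f g : Γ.L2)
    (u u' : E → ℝ → ℂ) (c : V → ℂ) : Prop where
  repr : ∀ e, f e =ᵐ[volume.restrict (Icc 0 (Γ.length e))] u e
  sobolev : ∀ e, IsSobolevTwo (Γ.length e) (u e) (u' e) (-(g e : ℝ → ℂ))
  continuity_src : ∀ e, u e 0 = c (Γ.src e)
  continuity_tgt : ∀ e, u e (Γ.length e) = c (Γ.tgt e)
  current : ∀ v, (∑ e with Γ.src e = v, u' e 0) - (∑ e with Γ.tgt e = v, u' e (Γ.length e))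
    = (if v ∈ R then (σ : ℂ) else 0) * c v

/-- The graph of the operator `H^{(σ)}`: all pairs `(f, -f'')`, where `f` is of class `W^{2,2}` on
every edge and satisfies the vertex conditions. -/
def robinGraph (Γ : MetricGraph V E) (R : Finset V) (σ : ℝ) : Submodule ℂ (Γ.L2 × Γ.L2) where
  carrier := {p | ∃ u u' c, Γ.IsRobinPair R σ p.1 p.2 u u' c}
  zero_mem' := by
    refine ⟨0, 0, 0, ?_, fun e => ?_, by simp, by simp, by simp⟩
    · intro e
      exact Lp.coeFn_zero _ _ _
    · have h0 : IsSobolevTwo (Γ.length e) 0 0 0 :=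
        ⟨continuousOn_const, continuousOn_const, MemLp.zero, fun φ _ _ _ => by simp,
          fun φ _ _ _ => by simp⟩
      refine h0.congr ?_
      filter_upwards [Lp.coeFn_zero ℂ 2 (volume.restrict (Icc 0 (Γ.length e)))] with x hx
      simpa using hx
  add_mem' := by
    rintro ⟨f, g⟩ ⟨f₂, g₂⟩ ⟨u, u', c, h⟩ ⟨v, v', d, k⟩
    refine ⟨u + v, u' + v', c + d, ?_, fun e => ?_, ?_, ?_, ?_⟩
    · intro e
      filter_upwards [Lp.coeFn_add (f e) (f₂ e), h.repr e, k.repr e] with x hx h1 h2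
      simp only [Prod.mk_add_mk, PiLp.add_apply] at h1 h2 ⊢
      rw [hx]
      simp [h1, h2]
    · refine ((h.sobolev e).add (k.sobolev e)).congr ?_
      filter_upwards [Lp.coeFn_add (g e) (g₂ e)] with x hx
      simp only [Prod.mk_add_mk, PiLp.add_apply, Pi.neg_apply, Pi.add_apply] at hx ⊢
      rw [hx]
      ring
    · intro e
      simp [h.continuity_src, k.continuity_src]
    · intro e
      simp [h.continuity_tgt, k.continuity_tgt]
    · intro w
      have h1 := h.current w
      have h2 := k.current w
      simp only [Pi.add_apply, Finset.sum_add_distrib, mul_add]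
      rw [← h1, ← h2]
      ring
  smul_mem' := by
    rintro a ⟨f, g⟩ ⟨u, u', c, h⟩
    refine ⟨a • u, a • u', a • c, ?_, fun e => ?_, ?_, ?_, ?_⟩
    · intro e
      filter_upwards [Lp.coeFn_smul a (f e), h.repr e] with x hx h1
      simp only [Prod.smul_mk, PiLp.smul_apply] at h1 ⊢
      rw [hx]
      simp [h1]
    · refine ((h.sobolev e).const_smul a).congr ?_
      filter_upwards [Lp.coeFn_smul a (g e)] with x hx
      simp only [Prod.smul_mk, PiLp.smul_apply, Pi.neg_apply, Pi.smul_apply, smul_neg] at hx ⊢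
      rw [hx]
    · intro e
      simp [h.continuity_src]
    · intro e
      simp [h.continuity_tgt]
    · intro w
      have h1 := h.current w
      simp only [Pi.smul_apply, smul_eq_mul, ← Finset.mul_sum]
      rw [mul_left_comm, ← h1]
      ring

/-- `-f''` is determined by `f`, so that `robinGraph` is the graph of an operator. -/
theorem robinGraph_single_valued (Γ : MetricGraph V E) (R : Finset V) (σ : ℝ)
    (p : Γ.L2 × Γ.L2) (hp : p ∈ Γ.robinGraph R σ) (h0 : p.1 = 0) : p.2 = 0 := by
  obtain ⟨f, g⟩ := p
  obtain ⟨u, u', c, h⟩ := hp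
  simp only at h0 h
  subst h0
  ext1 e
  have hu : u e =ᵐ[volume.restrict (Icc 0 (Γ.length e))] 0 :=
    (h.repr e).symm.trans (Lp.coeFn_zero _ _ _)
  have hu' := (h.sobolev e).weak.ae_eq_zero hu (h.sobolev e).cont'.integrableOn_Icc
  have hw := (h.sobolev e).weak'.ae_eq_zero hu' (h.sobolev e).integrable
  refine Lp.ext ?_
  filter_upwards [hw, Lp.coeFn_zero ℂ 2 (volume.restrict (Icc 0 (Γ.length e)))] with x hx h1
  simp only [Pi.neg_apply, Pi.zero_apply, neg_eq_zero] at hx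
  simp only [PiLp.zero_apply]
  rw [h1, hx]
  rfl

/-- The operator `H^{(σ)}` in `L²(Γ)`: it acts as `-d²/dx²` on every edge, with Robin condition of
parameter `σ` at the vertices of `R` and Neumann-Kirchhoff condition at the other vertices. -/
def robinLaplacian (Γ : MetricGraph V E) (R : Finset V) (σ : ℝ) : Γ.L2 →ₗ.[ℂ] Γ.L2 :=
  (Γ.robinGraph R σ).toLinearPMap

theorem robinLaplacian_graph (Γ : MetricGraph V E) (R : Finset V) (σ : ℝ) :
    (Γ.robinLaplacian R σ).graph = Γ.robinGraph R σ :=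
  Submodule.toLinearPMap_graph_eq _ (Γ.robinGraph_single_valued R σ)

/-- The space of all `f` in the domain of `H^{(σ)}` with `H^{(σ)} f = μ f`. -/
def eigenspace (Γ : MetricGraph V E) (R : Finset V) (σ : ℝ) (μ : ℂ) : Submodule ℂ Γ.L2 :=
  (Γ.robinLaplacian R σ).graph.comap (LinearMap.id.prod (μ • LinearMap.id))

theorem mem_eigenspace (Γ : MetricGraph V E) (R : Finset V) (σ : ℝ) (μ : ℂ) (f : Γ.L2) :
    f ∈ Γ.eigenspace R σ μ ↔
      ∃ hf : f ∈ (Γ.robinLaplacian R σ).domain, Γ.robinLaplacian R σ ⟨f, hf⟩ = μ • f := by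
  simp [eigenspace, LinearPMap.mem_graph_iff]

/-- The sequence `lam 0 ≤ lam 1 ≤ …` lists all the eigenvalues of `H^{(σ)}`, each repeated
according to its (finite) multiplicity, and tends to infinity. -/
structure IsEigenvalueSequence (Γ : MetricGraph V E) (R : Finset V) (σ : ℝ) (lam : ℕ → ℝ) :
    Prop where
  monotone : Monotone lam
  tendsto : Tendsto lam atTop atTop
  finite : ∀ μ : ℂ, FiniteDimensional ℂ (Γ.eigenspace R σ μ)
  multiplicity : ∀ μ : ℂ, Module.finrank ℂ (Γ.eigenspace R σ μ) = {n | (lam n : ℂ) = μ}.ncard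

/-- The `(n+1)`-st eigenvalue of `H^{(σ)}` in nondecreasing order, counted with multiplicity: the
least `t` such that the eigenvalues in `(-∞, t]` have total multiplicity at least `n + 1`. (The sum
of the eigenspaces is direct.) -/
def eigenvalue (Γ : MetricGraph V E) (R : Finset V) (σ : ℝ) (n : ℕ) : ℝ :=
  sInf {t : ℝ | ((n + 1 : ℕ) : Cardinal) ≤
    Module.rank ℂ (⨆ μ : Iic t, Γ.eigenspace R σ ((μ : ℝ) : ℂ) : Submodule ℂ Γ.L2)}

/-- The Robin-Neumann gap `λ_{n+1}(σ) - λ_{n+1}(0)`. -/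
def gap (Γ : MetricGraph V E) (R : Finset V) (n : ℕ) (σ : ℝ) : ℝ :=
  Γ.eigenvalue R σ n - Γ.eigenvalue R 0 n

end MetricGraph

end

/-! Heuristically `dλ/dσ = ∑_{v ∈ R} |f(v)|²` for a normalised eigenfunction `f`, so the theorem
amounts to a bound on the vertex values of eigenfunctions that is uniform in the eigenvalue and in
`σ`. For small eigenvalues `μ ≥ 0` this is the trace inequality together with `‖f'‖² ≤ μ‖f‖²`. For
large `μ` it comes from the conserved energy `A = |u'|² + μ|u|²` on an edge: `Re(ū u')` has
derivative `A - 2μ|u|²` and is `O(A/√μ)`, so integration gives `Aℓ ≤ 4μ‖u‖²`, hence `|u|² ≤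
(4/ℓ)‖u‖²` pointwise (`norm_sq_boundary_le`, `exists_boundaryForm_le_of_mem_eigenLift`).

The heuristic becomes a proof without differentiating eigenvalue branches. Let `t = λ_n(σ)` and use
the eigenfunctions at `σ` for eigenvalues up to `t` as trial space at `σ + h`. The uniform bound
holds for single eigenfunctions, not for their linear combinations, so a trial function is split as
`x + y`, with `y` in the eigenspace of `t` and `x` in the span of the eigenspaces below the
preceding gap. The uniform bound applies to `y`; the boundary term of `x` is absorbed by the gap
once `h` is small. Thus `λ_n(σ + h) ≤ λ_n(σ) + Ch` for `h ≤ δ(n, σ)`, where `C` depends on neither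
`n` nor `σ` (`exists_eigenvalue_add_le`). As `λ_n` is monotone and continuous, comparison of right
slopes removes the restriction on `h` (`exists_lipschitz_eigenvalue`).

The variational principle needs the operator in form language. A function is encoded by its vertex
values and edgewise derivative, which gives a form domain independent of `σ`. Green's formula
identifies `H^{(σ)}` with the operator of the form (`mem_robinGraph_iff`), and the form has a
compact positive resolvent at `-1` (`isCompactResolvent`). This yields the discrete spectrum, the
enumeration of the eigenvalues and the upper bound `eigenvalue_le_of_form_le`. -/

noncomputable section

/-! ### Counting the eigenvalues of an abstract family of eigenspaces -/

section Counting

variable {H : Type*} [AddCommGroup H] [Module ℂ H]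

/-- The span of the members of the family `F` with a real parameter at most `t`. -/
def spectralSpace (F : ℂ → Submodule ℂ H) (t : ℝ) : Submodule ℂ H :=
  ⨆ μ : Iic t, F ((μ : ℝ) : ℂ)

/-- The least `t` such that `spectralSpace F t` has dimension at least `n + 1`. -/
def orderedEigenvalue (F : ℂ → Submodule ℂ H) (n : ℕ) : ℝ :=
  sInf {t : ℝ | ((n + 1 : ℕ) : Cardinal) ≤ Module.rank ℂ (spectralSpace F t)}

/-- The family `F` behaves like the eigenspaces of a nonnegative operator with discrete spectrum. -/
structure DiscreteSpectrum (F : ℂ → Submodule ℂ H) : Prop where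
  real_nonneg : ∀ μ, F μ ≠ ⊥ → ∃ t : ℝ, 0 ≤ t ∧ μ = t
  indep : iSupIndep F
  finite : ∀ t, FiniteDimensional ℂ (spectralSpace F t)
  unbounded : ∀ n : ℕ, ∃ t, n < Module.finrank ℂ (spectralSpace F t)

namespace DiscreteSpectrum

variable {F : ℂ → Submodule ℂ H}

theorem le_spectralSpace {s t : ℝ} (h : s ≤ t) : F s ≤ spectralSpace F t :=
  le_iSup (fun μ : Iic t => F ((μ : ℝ) : ℂ)) ⟨s, h⟩

theorem spectralSpace_mono {s t : ℝ} (h : s ≤ t) : spectralSpace F s ≤ spectralSpace F t :=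
  iSup_le fun μ => le_spectralSpace (μ.2.trans h)

theorem finrank_mono (hF : DiscreteSpectrum F) {s t : ℝ} (h : s ≤ t) :
    Module.finrank ℂ (spectralSpace F s) ≤ Module.finrank ℂ (spectralSpace F t) :=
  have := hF.finite t
  Submodule.finrank_mono (spectralSpace_mono h)

theorem finiteDimensional (hF : DiscreteSpectrum F) (μ : ℂ) : FiniteDimensional ℂ (F μ) := by
  by_cases h : F μ = ⊥
  · rw [h]; infer_instance
  · obtain ⟨t, -, rfl⟩ := hF.real_nonneg μ h
    have := hF.finite t
    exact Submodule.finiteDimensional_of_le (le_spectralSpace le_rfl)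

/-- One nonzero vector per eigenvalue gives an independent family inside the finite-dimensional
`spectralSpace F t`. -/
theorem finite_setOf_ne_bot (hF : DiscreteSpectrum F) (t : ℝ) :
    {μ : ℝ | μ ≤ t ∧ F μ ≠ ⊥}.Finite := by
  have := hF.finite t
  have hex : ∀ μ : {μ : ℝ | μ ≤ t ∧ F μ ≠ ⊥}, ∃ x ∈ F (μ : ℝ), x ≠ 0 := fun μ =>
    Submodule.exists_mem_ne_zero_of_ne_bot μ.2.2
  choose x hx hx0 using hex
  have hli : LinearIndependent ℂ x :=
    (hF.indep.comp (f := fun μ : {μ : ℝ | μ ≤ t ∧ F μ ≠ ⊥} => ((μ : ℝ) : ℂ))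
      (Complex.ofReal_injective.comp Subtype.val_injective)).linearIndependent _ hx hx0
  have hli' : LinearIndependent ℂ
      (fun μ => (⟨x μ, le_spectralSpace μ.2.1 (hx μ)⟩ : spectralSpace F t)) :=
    LinearIndependent.of_comp (spectralSpace F t).subtype hli
  exact Set.finite_coe_iff.1 hli'.finite

theorem exists_gap (hF : DiscreteSpectrum F) (t : ℝ) :
    ∃ δ > 0, ∀ μ : ℝ, |μ - t| ≤ δ → μ ≠ t → F μ = ⊥ := by
  have hfin := (hF.finite_setOf_ne_bot (t + 1)).subset (sdiff_subset (t := {t}))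
  have hev : ∀ᶠ x in 𝓝 t, x ∉ {μ : ℝ | μ ≤ t + 1 ∧ F μ ≠ ⊥} \ {t} :=
    hfin.isClosed.isOpen_compl.mem_nhds (by simp)
  obtain ⟨ε, hε, hball⟩ := Metric.eventually_nhds_iff.1 hev
  refine ⟨min (ε / 2) 1, by positivity, fun μ hμ hne => ?_⟩
  by_contra h
  refine hball (y := μ) ?_ ⟨⟨?_, h⟩, hne⟩
  · rw [Real.dist_eq]
    linarith [min_le_left (ε / 2) 1]
  · linarith [min_le_right (ε / 2) 1, le_abs_self (μ - t)]

theorem spectralSpace_eq_of_gap {s t : ℝ} (hst : s ≤ t)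
    (h : ∀ μ : ℝ, s < μ → μ ≤ t → F μ = ⊥) : spectralSpace F t = spectralSpace F s := by
  refine le_antisymm (iSup_le fun μ => ?_) (spectralSpace_mono hst)
  rcases le_or_gt (μ : ℝ) s with hμ | hμ
  · exact le_spectralSpace hμ
  · rw [h μ hμ μ.2]; exact bot_le

theorem spectralSpace_eq_sup {s t : ℝ} (hst : s ≤ t)
    (h : ∀ μ : ℝ, s < μ → μ < t → F μ = ⊥) : spectralSpace F t = spectralSpace F s ⊔ F t := by
  refine le_antisymm (iSup_le fun μ => ?_) (sup_le (spectralSpace_mono hst) (le_spectralSpace le_rfl))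
  rcases le_or_gt (μ : ℝ) s with hμ | hμ
  · exact (le_spectralSpace hμ).trans le_sup_left
  · rcases (show (μ : ℝ) ≤ t from μ.2).eq_or_lt with he | hl
    · rw [he]; exact le_sup_right
    · rw [h μ hμ hl]; exact bot_le

theorem disjoint_spectralSpace (hF : DiscreteSpectrum F) {s t : ℝ} (hst : s < t) :
    Disjoint (spectralSpace F s) (F t) := by
  refine ((hF.indep (t : ℂ)).symm).mono_left (iSup_le fun μ => ?_)
  refine le_iSup₂_of_le (((μ : ℝ) : ℂ)) ?_ le_rfl
  have h1 : (μ : ℝ) ≤ s := μ.2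
  exact fun h => (h1.trans_lt hst).ne (Complex.ofReal_injective h)

theorem finrank_eq_add (hF : DiscreteSpectrum F) {s t : ℝ} (hst : s < t)
    (h : ∀ μ : ℝ, s < μ → μ < t → F μ = ⊥) :
    Module.finrank ℂ (spectralSpace F t)
      = Module.finrank ℂ (spectralSpace F s) + Module.finrank ℂ (F t) := by
  have := hF.finite s
  have := hF.finiteDimensional t
  have h1 := Submodule.finrank_sup_add_finrank_inf_eq (spectralSpace F s) (F t)
  rw [(hF.disjoint_spectralSpace hst).eq_bot, finrank_bot, add_zero,
    ← spectralSpace_eq_sup hst.le h] at h1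
  exact h1

theorem le_rank_iff (hF : DiscreteSpectrum F) (n : ℕ) (t : ℝ) :
    ((n + 1 : ℕ) : Cardinal) ≤ Module.rank ℂ (spectralSpace F t)
      ↔ n < Module.finrank ℂ (spectralSpace F t) := by
  have := hF.finite t
  rw [← Module.finrank_eq_rank, Nat.cast_le, Nat.succ_le_iff]

theorem spectralSpace_eq_bot (hF : DiscreteSpectrum F) {t : ℝ} (ht : t < 0) :
    spectralSpace F t = ⊥ := by
  refine eq_bot_iff.2 (iSup_le fun μ => ?_)
  by_contra h
  obtain ⟨r, hr, he⟩ := hF.real_nonneg ((μ : ℝ) : ℂ) (fun h' => h h'.le)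
  have h1 : (μ : ℝ) ≤ t := μ.2
  have h2 := Complex.ofReal_injective he
  linarith

/-- The dimension of `spectralSpace F t` is right-continuous in `t`, because a gap follows every
point; hence the infimum is attained. All properties of `orderedEigenvalue` are read off from this
equivalence. -/
theorem orderedEigenvalue_le_iff (hF : DiscreteSpectrum F) (n : ℕ) (t : ℝ) :
    orderedEigenvalue F n ≤ t ↔ n < Module.finrank ℂ (spectralSpace F t) := by
  have hbdd : BddBelow {t : ℝ | ((n + 1 : ℕ) : Cardinal) ≤ Module.rank ℂ (spectralSpace F t)} := by
    refine ⟨0, fun s hs => ?_⟩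
    by_contra hneg
    rw [mem_ofPred_eq, hF.le_rank_iff, hF.spectralSpace_eq_bot (not_le.1 hneg), finrank_bot] at hs
    omega
  constructor
  · intro h
    obtain ⟨δ, hδ, hgap⟩ := hF.exists_gap t
    obtain ⟨r, hr, hlt⟩ := exists_lt_of_csInf_lt
      (by obtain ⟨r, hr⟩ := hF.unbounded n
          exact ⟨r, (hF.le_rank_iff n r).2 hr⟩) (show orderedEigenvalue F n < t + δ by linarith)
    have h1 := (hF.le_rank_iff n r).1 hr
    rw [← spectralSpace_eq_of_gap (show t ≤ t + δ by linarith) (fun μ h1 h2 =>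
      hgap μ (by rw [abs_of_pos (by linarith)]; linarith) h1.ne')]
    exact h1.trans_le (hF.finrank_mono hlt.le)
  · intro h
    exact csInf_le hbdd ((hF.le_rank_iff n t).2 h)

theorem lt_finrank_orderedEigenvalue (hF : DiscreteSpectrum F) (n : ℕ) :
    n < Module.finrank ℂ (spectralSpace F (orderedEigenvalue F n)) :=
  (hF.orderedEigenvalue_le_iff n _).1 le_rfl

theorem orderedEigenvalue_nonneg (hF : DiscreteSpectrum F) (n : ℕ) :
    0 ≤ orderedEigenvalue F n := by
  by_contra h
  have := hF.lt_finrank_orderedEigenvalue n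
  rw [hF.spectralSpace_eq_bot (not_le.1 h), finrank_bot] at this
  omega

theorem orderedEigenvalue_monotone (hF : DiscreteSpectrum F) : Monotone (orderedEigenvalue F) :=
  fun _ n hmn => (hF.orderedEigenvalue_le_iff _ _).2
    (hmn.trans_lt (hF.lt_finrank_orderedEigenvalue n))

theorem tendsto_orderedEigenvalue (hF : DiscreteSpectrum F) :
    Tendsto (orderedEigenvalue F) atTop atTop := by
  refine tendsto_atTop.2 fun t => ?_
  filter_upwards [eventually_ge_atTop (Module.finrank ℂ (spectralSpace F t))] with n hn
  by_contra h
  exact absurd ((hF.orderedEigenvalue_le_iff n t).1 (not_le.1 h).le) (not_lt.2 hn)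

/-- With `N(t)` the dimension of `spectralSpace F t`, the indices whose eigenvalue is `t` are those
with `N(t - δ) ≤ n < N(t)`. As `(t - δ, t)` contains no eigenvalue, `N` increases by exactly `dim (F
t)`. For non-real `μ` both sides are zero. -/
theorem finrank_eq_ncard (hF : DiscreteSpectrum F) (μ : ℂ) :
    Module.finrank ℂ (F μ) = {n | (orderedEigenvalue F n : ℂ) = μ}.ncard := by
  by_cases hre : ∃ t : ℝ, μ = t
  · obtain ⟨t, rfl⟩ := hre
    obtain ⟨δ, hδ, hgap⟩ := hF.exists_gap t
    have hgap' : ∀ μ : ℝ, t - δ < μ → μ < t → F μ = ⊥ := fun μ h1 h2 =>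
      hgap μ (by rw [abs_of_neg (by linarith)]; linarith) h2.ne
    have hset : {n | (orderedEigenvalue F n : ℂ) = (t : ℂ)}
        = Finset.Ico (Module.finrank ℂ (spectralSpace F (t - δ)))
          (Module.finrank ℂ (spectralSpace F t)) := by
      ext n
      rw [mem_ofPred_eq, Complex.ofReal_inj, Finset.coe_Ico, mem_Ico,
        ← hF.orderedEigenvalue_le_iff n t, ← not_lt, ← hF.orderedEigenvalue_le_iff n (t - δ)]
      refine ⟨fun h => ⟨by linarith, h.le⟩, fun h => ?_⟩
      refine h.2.eq_or_lt.resolve_right fun hlt => h.1 ?_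
      obtain ⟨s, hs1, hs2⟩ := exists_between (max_lt hlt (show t - δ < t by linarith))
      have h3 := (hF.orderedEigenvalue_le_iff n s).1 ((le_max_left _ _).trans hs1.le)
      rw [spectralSpace_eq_of_gap ((le_max_right _ _).trans hs1.le)
        (fun μ h1 h2 => hgap' μ h1 (h2.trans_lt hs2))] at h3
      exact (hF.orderedEigenvalue_le_iff n _).2 h3
    rw [hset, Set.ncard_coe_finset, Nat.card_Ico,
      hF.finrank_eq_add (show t - δ < t by linarith) hgap']
    omega
  · have h0 : F μ = ⊥ := by
      by_contra h
      obtain ⟨t, -, ht⟩ := hF.real_nonneg μ h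
      exact hre ⟨t, ht⟩
    have hset : {n | (orderedEigenvalue F n : ℂ) = μ} = ∅ := by
      ext n
      simp only [mem_ofPred_eq, mem_empty_iff_false, iff_false]
      exact fun h => hre ⟨_, h.symm⟩
    rw [h0, hset, finrank_bot, Set.ncard_empty]

end DiscreteSpectrum

end Counting


/-! ### Spectral theory of compact positive resolvents -/

section CompactPositive

open Module.End

section Weights

variable {M H ι : Type*} [AddCommGroup M] [Module ℂ M] [NormedAddCommGroup H]
  [InnerProductSpace ℂ H]

/-- Hermitian symmetry makes the images under `J` of eigenvectors for distinct parameters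
orthogonal, so the form is diagonal on their span and the weights are `‖J (f i)‖ ^ 2`. -/
theorem exists_weights (b : M →ₗ⋆[ℂ] M →ₗ[ℂ] ℂ) (J : M →ₗ[ℂ] H)
    (hb : ∀ w w', b w' w = starRingEnd ℂ (b w w')) (S : ι → Submodule ℂ M) (μ : ι → ℝ)
    (hμ : Function.Injective μ) (hS : ∀ i, ∀ w ∈ S i, ∀ w', b w w' = μ i * inner ℂ (J w) (J w'))
    {w : M} (hw : w ∈ ⨆ i, S i) :
    ∃ (s : Finset ι) (a : ι → ℝ), (∀ i, 0 ≤ a i) ∧ (b w w).re = ∑ i ∈ s, μ i * a i ∧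
      ‖J w‖ ^ 2 = ∑ i ∈ s, a i := by
  obtain ⟨f, hf, rfl⟩ := (Submodule.mem_iSup_iff_exists_finsupp S w).1 hw
  have horth : ∀ i j, i ≠ j → inner ℂ (J (f i)) (J (f j)) = 0 := by
    intro i j hij
    have h1 := hS i (f i) (hf i) (f j)
    have h2 := hS j (f j) (hf j) (f i)
    rw [hb, h1, map_mul, Complex.conj_ofReal, inner_conj_symm] at h2
    have h3 : (((μ i - μ j : ℝ)) : ℂ) * inner ℂ (J (f j)) (J (f i)) = 0 := by
      push_cast
      rw [sub_mul, h2, sub_self]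
    rcases mul_eq_zero.1 h3 with h | h
    · exact absurd (hμ (sub_eq_zero.1 (Complex.ofReal_eq_zero.1 h))) hij
    · exact inner_eq_zero_symm.1 h
  have hrow : ∀ i ∈ f.support, inner ℂ (J (f i)) (J (f.sum fun _ x => x))
      = ((‖J (f i)‖ ^ 2 : ℝ) : ℂ) := by
    intro i hi
    rw [Finsupp.sum, map_sum, inner_sum, Finset.sum_eq_single_of_mem i hi
      (fun j _ hji => horth i j hji.symm), inner_self_eq_norm_sq_to_K]
    push_cast
    rfl
  refine ⟨f.support, fun i => ‖J (f i)‖ ^ 2, fun i => by positivity, ?_, ?_⟩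
  · have h1 : b (f.sum fun _ x => x) (f.sum fun _ x => x)
        = ∑ i ∈ f.support, ((μ i * ‖J (f i)‖ ^ 2 : ℝ) : ℂ) := by
      have h0 : ∀ y, b (f.sum fun _ x => x) y = ∑ i ∈ f.support, b (f i) y := fun y => by
        rw [Finsupp.sum, map_sum, LinearMap.sum_apply]
      rw [h0]
      refine Finset.sum_congr rfl fun i hi => ?_
      rw [hS i (f i) (hf i), hrow i hi]
      push_cast
      rfl
    rw [h1, Complex.re_sum]
    simp only [Complex.ofReal_re]
  · have h1 : inner ℂ (J (f.sum fun _ x => x)) (J (f.sum fun _ x => x))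
        = ∑ i ∈ f.support, ((‖J (f i)‖ ^ 2 : ℝ) : ℂ) := by
      conv_lhs => rw [Finsupp.sum, map_sum, sum_inner]
      refine Finset.sum_congr rfl fun i hi => ?_
      have h2 := hrow i hi
      rw [Finsupp.sum, map_sum] at h2
      exact h2
    rw [inner_self_eq_norm_sq_to_K] at h1
    refine Complex.ofReal_injective ?_
    push_cast at h1 ⊢
    exact h1

theorem form_le_of_mem_iSup (b : M →ₗ⋆[ℂ] M →ₗ[ℂ] ℂ) (J : M →ₗ[ℂ] H)
    (hb : ∀ w w', b w' w = starRingEnd ℂ (b w w')) (S : ι → Submodule ℂ M) (μ : ι → ℝ)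
    (hμ : Function.Injective μ) (hS : ∀ i, ∀ w ∈ S i, ∀ w', b w w' = μ i * inner ℂ (J w) (J w'))
    {t : ℝ} (ht : ∀ i, μ i ≤ t) {w : M} (hw : w ∈ ⨆ i, S i) :
    (b w w).re ≤ t * ‖J w‖ ^ 2 := by
  obtain ⟨s, a, ha, h1, h2⟩ := exists_weights b J hb S μ hμ hS hw
  rw [h1, h2, Finset.mul_sum]
  exact Finset.sum_le_sum fun i _ => mul_le_mul_of_nonneg_right (ht i) (ha i)

theorem le_form_of_mem_iSup (b : M →ₗ⋆[ℂ] M →ₗ[ℂ] ℂ) (J : M →ₗ[ℂ] H)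
    (hb : ∀ w w', b w' w = starRingEnd ℂ (b w w')) (S : ι → Submodule ℂ M) (μ : ι → ℝ)
    (hμ : Function.Injective μ) (hS : ∀ i, ∀ w ∈ S i, ∀ w', b w w' = μ i * inner ℂ (J w) (J w'))
    {t : ℝ} (ht : ∀ i, t ≤ μ i) {w : M} (hw : w ∈ ⨆ i, S i) :
    t * ‖J w‖ ^ 2 ≤ (b w w).re := by
  obtain ⟨s, a, ha, h1, h2⟩ := exists_weights b J hb S μ hμ hS hw
  rw [h1, h2, Finset.mul_sum]
  exact Finset.sum_le_sum fun i _ => mul_le_mul_of_nonneg_right (ht i) (ha i)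

end Weights

variable {H : Type*} [NormedAddCommGroup H] [InnerProductSpace ℂ H]

/-- The norm of a nonzero positive compact operator is one of its eigenvalues. -/
theorem hasEigenvalue_norm_of_compact_positive {T : H →L[ℂ] H} [CompleteSpace H]
    (hc : IsCompactOperator T) (hs : T.IsSymmetric)
    (hpos : ∀ x, 0 ≤ (inner ℂ (T x) x).re) (h0 : T ≠ 0) :
    HasEigenvalue (T : Module.End ℂ H) ((‖T‖ : ℝ) : ℂ) := by
  have : Nontrivial H := by
    by_contra h
    rw [not_nontrivial_iff_subsingleton] at h
    exact h0 (Subsingleton.elim _ _)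
  have hne : ((‖T‖ : ℝ) : ℂ) ≠ 0 := by simpa using h0
  refine (hc.hasEigenvalue_or_mem_resolventSet hne).resolve_right fun hr => ?_
  -- If `‖T‖` were in the resolvent set, the Rayleigh quotients would stay below `‖T‖ - ε`. By
  -- positivity they equal their absolute values, whose supremum is `‖T‖`.
  obtain ⟨ε, hε, hle⟩ := T.rayleighQuotient_le_of_norm_mem_resolventSet (𝕜 := ℂ) hr
  have h1 := T.norm_eq_iSup_rayleighQuotient hs
  have h2 : ⨆ x, |T.rayleighQuotient x| ≤ ‖T‖ - ε := by
    refine ciSup_le fun x => ?_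
    rw [abs_of_nonneg]
    · exact hle x
    · exact div_nonneg (hpos x) (by positivity)
  linarith

/-- The properties of an operator that make it the resolvent at `-1` of a nonnegative operator
with discrete spectrum. -/
structure IsCompactResolvent (T : H →L[ℂ] H) : Prop where
  compact : IsCompactOperator T
  symm : T.IsSymmetric
  pos : ∀ x, x ≠ 0 → 0 < (inner ℂ (T x) x).re
  le : ∀ x, (inner ℂ (T x) x).re ≤ ‖x‖ ^ 2

namespace IsCompactResolvent

variable {T : H →L[ℂ] H}

/-- The eigenspaces of the operator whose resolvent at `-1` is `T`. -/
def family (T : H →L[ℂ] H) (μ : ℂ) : Submodule ℂ H :=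
  eigenspace (T : Module.End ℂ H) (1 + μ)⁻¹

theorem mem_family {μ : ℂ} {x : H} : x ∈ family T μ ↔ T x = (1 + μ)⁻¹ • x := mem_eigenspace_iff

/-- An eigenvalue `r` of `T` is real, and `pos` and `le` place it in `(0, 1]`, so `μ = r⁻¹ - 1 ≥ 0`.
The value `μ = -1` is excluded by `r > 0`, since `0⁻¹ = 0`. -/
theorem real_nonneg (hT : IsCompactResolvent T) (μ : ℂ) (hμ : family T μ ≠ ⊥) :
    ∃ t : ℝ, 0 ≤ t ∧ μ = t := by
  obtain ⟨x, hx, hx0⟩ := Submodule.exists_mem_ne_zero_of_ne_bot hμ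
  rw [mem_family] at hx
  have hc : starRingEnd ℂ (1 + μ)⁻¹ = (1 + μ)⁻¹ :=
    hT.symm.conj_eigenvalue_eq_self (hasEigenvalue_of_hasEigenvector ⟨mem_eigenspace_iff.2 hx, hx0⟩)
  obtain ⟨r, hr⟩ := Complex.conj_eq_iff_real.1 hc
  have hn : 0 < ‖x‖ ^ 2 := by positivity
  have hin : (inner ℂ (T x) x).re = r * ‖x‖ ^ 2 := by
    rw [hx, hr, inner_smul_left, Complex.conj_ofReal, Complex.re_ofReal_mul]
    exact congrArg (r * ·) (inner_self_eq_norm_sq (𝕜 := ℂ) x)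
  have h1 := hT.pos x hx0
  have h2 := hT.le x
  rw [hin] at h1 h2
  have hr0 : 0 < r := pos_of_mul_pos_left h1 hn.le
  have hr1 : r ≤ 1 := by nlinarith
  refine ⟨r⁻¹ - 1, by linarith [(one_le_inv₀ hr0).2 hr1], ?_⟩
  have : 1 + μ = ((r⁻¹ : ℝ) : ℂ) := by
    rw [Complex.ofReal_inv, ← hr, inv_inv]
  push_cast at this ⊢
  rw [← this]
  ring

theorem family_eq_bot_of_neg (hT : IsCompactResolvent T) {t : ℝ} (ht : t < 0) :
    family T t = ⊥ := by
  by_contra h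
  obtain ⟨s, hs, he⟩ := hT.real_nonneg t h
  have := Complex.ofReal_injective he
  linarith

theorem iSupIndep_family (T : H →L[ℂ] H) : iSupIndep (family T) :=
  (Module.End.eigenspaces_iSupIndep (T : Module.End ℂ H)).comp
    (f := fun μ : ℂ => (1 + μ)⁻¹) (fun μ ν h => by simpa using h)

theorem spectralSpace_eq (hT : IsCompactResolvent T) (t : ℝ) :
    spectralSpace (family T) t = ⨆ μ : Icc (0 : ℝ) t, family T ((μ : ℝ) : ℂ) := by
  refine le_antisymm (iSup_le fun μ => ?_) (iSup_le fun μ => ?_)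
  · rcases lt_or_ge (μ : ℝ) 0 with h | h
    · rw [hT.family_eq_bot_of_neg h]; exact bot_le
    · exact le_iSup (fun μ : Icc (0 : ℝ) t => family T ((μ : ℝ) : ℂ)) ⟨μ, h, μ.2⟩
  · exact DiscreteSpectrum.le_spectralSpace μ.2.2

/-- On this span the eigenvalues of `T` are at least `(1 + |t|)⁻¹`, so `⟨T x, x⟩` is bounded below,
and Cauchy–Schwarz turns this into a bound for `‖T x‖`. -/
theorem norm_le_of_mem_spectralSpace (hT : IsCompactResolvent T) {t : ℝ} {x : H}
    (hx : x ∈ spectralSpace (family T) t) : ‖x‖ ≤ (1 + |t|) * ‖T x‖ := by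
  rw [hT.spectralSpace_eq] at hx
  have h := le_form_of_mem_iSup ((innerₛₗ ℂ).comp (T : H →ₗ[ℂ] H)) LinearMap.id
    (fun w w' => by
      have := hT.symm w w'
      simp only [LinearMap.comp_apply, innerₛₗ_apply_apply, ContinuousLinearMap.coe_coe] at this ⊢
      rw [this, inner_conj_symm])
    (fun μ : Icc (0 : ℝ) t => family T ((μ : ℝ) : ℂ)) (fun μ => (1 + (μ : ℝ))⁻¹)
    (fun μ ν h => Subtype.ext (by simpa using h))
    (fun μ w hw w' => by
      have h1 : T w = _ := mem_family.1 hw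
      simp only [LinearMap.comp_apply, innerₛₗ_apply_apply, ContinuousLinearMap.coe_coe,
        LinearMap.id_apply]
      rw [h1, inner_smul_left, ← Complex.ofReal_one, ← Complex.ofReal_add, ← Complex.ofReal_inv,
        Complex.conj_ofReal])
    (t := (1 + |t|)⁻¹) (fun μ => inv_anti₀ (by linarith [μ.2.1])
      (by linarith [μ.2.2, le_abs_self t])) hx
  simp only [LinearMap.comp_apply, innerₛₗ_apply_apply, ContinuousLinearMap.coe_coe,
    LinearMap.id_apply] at h
  have h2 : (inner ℂ (T x) x).re ≤ ‖T x‖ * ‖x‖ := re_inner_le_norm (𝕜 := ℂ) (T x) x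
  have h3 : 0 < 1 + |t| := by positivity
  have h4 := h.trans h2
  rw [inv_mul_le_iff₀ h3, sq, ← mul_assoc] at h4
  rcases (norm_nonneg x).eq_or_lt with h5 | h5
  · rw [← h5]; positivity
  · exact le_of_mul_le_mul_right h4 h5

theorem map_mem_spectralSpace {t : ℝ} {x : H} (hx : x ∈ spectralSpace (family T) t) :
    T x ∈ spectralSpace (family T) t := by
  refine Submodule.iSup_induction _ (motive := fun x => T x ∈ spectralSpace (family T) t) hx
    (fun μ y hy => ?_) (by simp) (fun y z hy hz => by rw [map_add]; exact add_mem hy hz)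
  rw [mem_family.1 hy]
  exact Submodule.smul_mem _ _ (DiscreteSpectrum.le_spectralSpace μ.2 hy)

/-- The lower bound on `T` extends to the closure of the spectral space, where `T` is then a compact
closed embedding. Hence the identity there is compact, and Riesz's theorem applies. -/
theorem finiteDimensional_spectralSpace [CompleteSpace H] (hT : IsCompactResolvent T) (t : ℝ) :
    FiniteDimensional ℂ (spectralSpace (family T) t) := by
  set X := spectralSpace (family T) t with hX
  have hclos : ∀ x ∈ X.topologicalClosure, ‖x‖ ≤ (1 + |t|) * ‖T x‖ := by
    intro x hx
    refine closure_minimal (s := (X : Set H)) (t := {x | ‖x‖ ≤ (1 + |t|) * ‖T x‖})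
      (fun y hy => hT.norm_le_of_mem_spectralSpace hy) ?_ hx
    exact isClosed_le continuous_norm (by fun_prop)
  have hinv : ∀ x ∈ X.topologicalClosure, T x ∈ X.topologicalClosure := by
    intro x hx
    exact map_mem_closure T.continuous hx (fun y hy => map_mem_spectralSpace hy)
  have : CompleteSpace X.topologicalClosure := X.isClosed_topologicalClosure.completeSpace_coe
  have hS := hT.compact.restrict' (f := (T : H →ₗ[ℂ] H)) hinv
  obtain ⟨K, hK, hKn⟩ := hS
  let S : X.topologicalClosure →L[ℂ] X.topologicalClosure := T.restrict hinv
  have hanti : AntilipschitzWith (1 + |t|).toNNReal S := by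
    refine ContinuousLinearMap.antilipschitz_of_bound S fun x => ?_
    rw [Real.coe_toNNReal _ (by positivity)]
    exact hclos x x.2
  have hid : IsCompactOperator (id : X.topologicalClosure → X.topologicalClosure) :=
    ⟨S ⁻¹' K, (hanti.isClosedEmbedding S.uniformContinuous).isCompact_preimage hK, hKn⟩
  have := FiniteDimensional.of_isCompactOperator_id (𝕜 := ℂ) hid
  exact Submodule.finiteDimensional_of_le X.le_topologicalClosure

/-- On the orthogonal complement of the eigenvectors for eigenvalues up to `t` the quadratic form
of the resolvent is smaller than `(1 + t)⁻¹`. -/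
theorem re_inner_lt [CompleteSpace H] (hT : IsCompactResolvent T) {t : ℝ} (ht : 0 ≤ t) {x : H}
    (hx : x ∈ (spectralSpace (family T) t)ᗮ) (hx0 : x ≠ 0) :
    (inner ℂ (T x) x).re < (1 + t)⁻¹ * ‖x‖ ^ 2 := by
  set M := (spectralSpace (family T) t)ᗮ with hM
  have hinv : ∀ x ∈ M, T x ∈ M := by
    intro x hx y hy
    have h1 : inner ℂ (T y) x = inner ℂ y (T x) := hT.symm y x
    rw [← h1]
    exact hx _ (map_mem_spectralSpace hy)
  let S : M →L[ℂ] M := T.restrict hinv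
  have hSc : IsCompactOperator S := hT.compact.restrict' (f := (T : H →ₗ[ℂ] H)) hinv
  have hSs : S.IsSymmetric := hT.symm.restrict_invariant hinv
  have hSp : ∀ x, 0 ≤ (inner ℂ (S x) x).re := by
    intro x
    rcases eq_or_ne (x : H) 0 with h | h
    · have : x = 0 := Subtype.ext h
      simp [this]
    · exact (hT.pos x h).le
  -- Otherwise `‖S‖` is an eigenvalue of `T` with parameter `‖S‖⁻¹ - 1 ≤ t`, and its eigenvector
  -- lies both in the spectral space and in its orthogonal complement.
  have hlt : ‖S‖ < (1 + t)⁻¹ := by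
    by_contra hge
    rw [not_lt] at hge
    have hpos : 0 < ‖S‖ := lt_of_lt_of_le (by positivity) hge
    obtain ⟨v, hv, hv0⟩ :=
      (hasEigenvalue_norm_of_compact_positive hSc hSs hSp (norm_pos_iff.1 hpos)).exists_hasEigenvector
    have hv1 : T v = ((‖S‖ : ℝ) : ℂ) • (v : H) := congrArg Subtype.val (mem_eigenspace_iff.1 hv)
    have hmem : (v : H) ∈ family T ((‖S‖⁻¹ - 1 : ℝ) : ℂ) := by
      rw [mem_family, hv1]
      congr 1
      push_cast
      rw [add_sub_cancel, inv_inv]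
    have hle : ‖S‖⁻¹ - 1 ≤ t := by
      have := inv_anti₀ (by positivity) hge
      rw [inv_inv] at this
      linarith
    have h0 := v.2 _ (DiscreteSpectrum.le_spectralSpace hle hmem)
    exact hv0 (Subtype.ext (inner_self_eq_zero.1 h0))
  have hn : 0 < ‖x‖ ^ 2 := by positivity
  have h1 : (inner ℂ (T x) x).re ≤ ‖S ⟨x, hx⟩‖ * ‖x‖ := re_inner_le_norm (𝕜 := ℂ) (T x) x
  have h2 : ‖S ⟨x, hx⟩‖ ≤ ‖S‖ * ‖x‖ := S.le_opNorm ⟨x, hx⟩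
  calc (inner ℂ (T x) x).re ≤ ‖S‖ * ‖x‖ * ‖x‖ := h1.trans (by gcongr)
    _ = ‖S‖ * ‖x‖ ^ 2 := by ring
    _ < _ := by gcongr

/-- If the dimensions were bounded, the spectral spaces would stabilise. A nonzero vector orthogonal
to the stable space, which exists in infinite dimension, would satisfy `⟨T x, x⟩ ≤ (1 + t)⁻¹ ‖x‖²`
for all large `t`, contradicting `pos`. -/
theorem discreteSpectrum [CompleteSpace H] (hT : IsCompactResolvent T)
    (hinf : ¬ FiniteDimensional ℂ H) : DiscreteSpectrum (family T) where
  real_nonneg := hT.real_nonneg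
  indep := iSupIndep_family T
  finite := hT.finiteDimensional_spectralSpace
  unbounded := by
    by_contra! hcon
    obtain ⟨n, hn⟩ := hcon
    have hfin := hT.finiteDimensional_spectralSpace
    have hbdd : BddAbove (range fun t => Module.finrank ℂ (spectralSpace (family T) t)) :=
      ⟨n, by rintro _ ⟨t, rfl⟩; exact hn t⟩
    obtain ⟨t₀, ht₀⟩ := Nat.sSup_mem (range_nonempty _) hbdd
    have hmax : ∀ t, Module.finrank ℂ (spectralSpace (family T) t)
        ≤ Module.finrank ℂ (spectralSpace (family T) t₀) := by
      intro t
      rw [show Module.finrank ℂ (spectralSpace (family T) t₀) = _ from ht₀]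
      exact le_csSup hbdd (mem_range_self t)
    have hstab : ∀ t, t₀ ≤ t → spectralSpace (family T) t = spectralSpace (family T) t₀ :=
      fun t ht => (Submodule.eq_of_le_of_finrank_le (DiscreteSpectrum.spectralSpace_mono ht)
        (hmax t)).symm
    have hne : (spectralSpace (family T) t₀)ᗮ ≠ ⊥ := by
      intro h
      rw [Submodule.orthogonal_eq_bot_iff] at h
      have h1 := hfin t₀
      rw [h] at h1
      exact hinf (Module.finite_def.2 (Module.Finite.iff_fg.1 h1))
    obtain ⟨x, hx, hx0⟩ := Submodule.exists_mem_ne_zero_of_ne_bot hne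
    have hlt : ∀ t, max t₀ 0 ≤ t → (inner ℂ (T x) x).re ≤ (1 + t)⁻¹ * ‖x‖ ^ 2 := by
      intro t ht
      refine (hT.re_inner_lt ((le_max_right _ _).trans ht) ?_ hx0).le
      rwa [hstab t ((le_max_left _ _).trans ht)]
    have hlim : Tendsto (fun t : ℝ => (1 + t)⁻¹ * ‖x‖ ^ 2) atTop (𝓝 (0 * ‖x‖ ^ 2)) :=
      (tendsto_inv_atTop_zero.comp (tendsto_atTop_add_const_left _ 1 tendsto_id)).mul_const _
    have := ge_of_tendsto hlim ((eventually_ge_atTop _).mono hlt)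
    rw [zero_mul] at this
    exact absurd (hT.pos x hx0) (not_lt.2 this)

end IsCompactResolvent

end CompactPositive


/-! ### Functions on one edge and the integration operator -/

/-- The space `L²([0, ℓ])`. -/
abbrev EdgeL2 (ℓ : ℝ) : Type := Lp ℂ 2 (volume.restrict (Icc 0 ℓ))

namespace EdgeL2

variable {ℓ : ℝ}

theorem integrableOn (f : EdgeL2 ℓ) : IntegrableOn f (Icc 0 ℓ) :=
  (Lp.memLp f).integrable (by norm_num)

theorem intervalIntegrable (f : EdgeL2 ℓ) {x y : ℝ} (hx : x ∈ Icc 0 ℓ) (hy : y ∈ Icc 0 ℓ) :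
    IntervalIntegrable f volume x y :=
  (f.integrableOn.mono_set (ordConnected_Icc.uIcc_subset hx hy)).intervalIntegrable

theorem inner_eq (f g : EdgeL2 ℓ) :
    inner ℂ f g = ∫ x in Icc 0 ℓ, starRingEnd ℂ (f x) * g x := by
  rw [L2.inner_def]
  refine integral_congr_ae (Eventually.of_forall fun x => ?_)
  simp only [RCLike.inner_apply]
  ring

/-- Cauchy–Schwarz against the indicator of the interval. This Hölder bound later supplies
equicontinuity for Arzelà–Ascoli. -/
theorem norm_integral_le (f : EdgeL2 ℓ) {x y : ℝ} (hx : x ∈ Icc 0 ℓ) (hy : y ∈ Icc 0 ℓ) :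
    ‖∫ z in x..y, f z‖ ≤ √|y - x| * ‖f‖ := by
  wlog hxy : x ≤ y generalizing x y
  · rw [intervalIntegral.integral_symm, norm_neg, abs_sub_comm]
    exact this hy hx (not_le.1 hxy).le
  have hsub : Ioc x y ⊆ Icc 0 ℓ := fun z hz => ⟨hx.1.trans hz.1.le, hz.2.trans hy.2⟩
  have h1 : ∫ z in x..y, f z = inner ℂ (indicatorConstLp 2
      (measurableSet_Ioc (a := x) (b := y)) (measure_ne_top _ _) (1 : ℂ)) f := by
    rw [L2.inner_indicatorConstLp_one, intervalIntegral.integral_of_le hxy,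
      Measure.restrict_restrict measurableSet_Ioc, inter_eq_left.2 hsub]
  rw [h1]
  refine (norm_inner_le_norm _ _).trans ?_
  gcongr
  rw [norm_indicatorConstLp (by norm_num) (by norm_num), norm_one, one_mul, measureReal_def,
    Measure.restrict_apply measurableSet_Ioc, inter_eq_left.2 hsub, Real.volume_Ioc,
    ENNReal.toReal_ofReal (by linarith), abs_of_nonneg (by linarith), Real.sqrt_eq_rpow]
  norm_num

theorem continuousOn_primitive (f : EdgeL2 ℓ) :
    ContinuousOn (fun x => ∫ y in (0 : ℝ)..x, f y) (Icc 0 ℓ) := by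
  rcases le_or_gt 0 ℓ with h | h
  · have := intervalIntegral.continuousOn_primitive_interval (μ := volume) (f := f) (a := 0) (b := ℓ)
      (by rw [uIcc_of_le h]; exact f.integrableOn)
    rwa [uIcc_of_le h] at this
  · exact fun x hx => absurd (hx.1.trans hx.2) (not_le.2 h)

theorem norm_primitive_le (f : EdgeL2 ℓ) {x : ℝ} (hx : x ∈ Icc 0 ℓ) :
    ‖∫ y in (0 : ℝ)..x, f y‖ ≤ √ℓ * ‖f‖ := by
  refine (f.norm_integral_le ⟨le_rfl, hx.1.trans hx.2⟩ hx).trans ?_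
  gcongr
  rw [sub_zero, abs_of_nonneg hx.1]
  exact hx.2

theorem memLp_of_continuousOn {u : ℝ → ℂ} (hu : ContinuousOn u (Icc 0 ℓ)) :
    MemLp u 2 (volume.restrict (Icc 0 ℓ)) := by
  obtain ⟨C, hC⟩ := isCompact_Icc.exists_bound_of_continuousOn hu
  exact MemLp.of_bound (hu.aestronglyMeasurable measurableSet_Icc) C
    ((ae_restrict_iff' measurableSet_Icc).2 (Eventually.of_forall hC))

/-- The operator of integration from the left end of the interval. -/
def volterra (ℓ : ℝ) : EdgeL2 ℓ →L[ℂ] EdgeL2 ℓ :=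
  LinearMap.mkContinuous
    { toFun := fun f => (memLp_of_continuousOn f.continuousOn_primitive).toLp _
      map_add' := fun f g => by
        rw [← MemLp.toLp_add]
        refine MemLp.toLp_congr _ _ ((ae_restrict_iff' measurableSet_Icc).2
          (Eventually.of_forall fun x hx => ?_))
        have h0 : (0 : ℝ) ∈ Icc 0 ℓ := ⟨le_rfl, hx.1.trans hx.2⟩
        simp only [Pi.add_apply]
        rw [← intervalIntegral.integral_add (f.intervalIntegrable h0 hx)
          (g.intervalIntegrable h0 hx)]
        refine intervalIntegral.integral_congr_ae ?_
        have h2 := (ae_restrict_iff' measurableSet_Icc).1 (Lp.coeFn_add f g)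
        filter_upwards [h2] with y hy hmem
        rw [uIoc_of_le hx.1] at hmem
        exact hy ⟨hmem.1.le, hmem.2.trans hx.2⟩
      map_smul' := fun c f => by
        rw [RingHom.id_apply, ← MemLp.toLp_const_smul]
        refine MemLp.toLp_congr _ _ ((ae_restrict_iff' measurableSet_Icc).2
          (Eventually.of_forall fun x hx => ?_))
        simp only [Pi.smul_apply]
        rw [← intervalIntegral.integral_smul]
        refine intervalIntegral.integral_congr_ae ?_
        have h2 := (ae_restrict_iff' measurableSet_Icc).1 (Lp.coeFn_smul c f)
        filter_upwards [h2] with y hy hmem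
        rw [uIoc_of_le hx.1] at hmem
        exact hy ⟨hmem.1.le, hmem.2.trans hx.2⟩ }
    ((measureUnivNNReal (volume.restrict (Icc (0 : ℝ) ℓ)) : ℝ) ^ (2 : ENNReal).toReal⁻¹ * √ℓ)
    fun f => by
      rw [mul_assoc]
      refine Lp.norm_le_of_ae_bound (by positivity) ?_
      filter_upwards [MemLp.coeFn_toLp (memLp_of_continuousOn f.continuousOn_primitive),
        ae_restrict_mem measurableSet_Icc] with x h1 h2
      simp only [LinearMap.coe_mk, AddHom.coe_mk]
      rw [h1]
      exact f.norm_primitive_le h2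

theorem coeFn_volterra (f : EdgeL2 ℓ) :
    volterra ℓ f =ᵐ[volume.restrict (Icc 0 ℓ)] fun x => ∫ y in (0 : ℝ)..x, f y :=
  MemLp.coeFn_toLp (memLp_of_continuousOn f.continuousOn_primitive)

/-- The constant function `1`. -/
def one (ℓ : ℝ) : EdgeL2 ℓ := Lp.const 2 (volume.restrict (Icc 0 ℓ)) (1 : ℂ)

theorem coeFn_one : (one ℓ : ℝ → ℂ) =ᵐ[volume.restrict (Icc 0 ℓ)] fun _ => 1 :=
  Lp.coeFn_const _ _ _

theorem inner_one (f : EdgeL2 ℓ) : inner ℂ (one ℓ) f = ∫ x in Icc 0 ℓ, f x := by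
  rw [inner_eq]
  exact integral_congr_ae (coeFn_one.mono fun x hx => by simp [hx])

theorem inner_one_eq (hℓ : 0 ≤ ℓ) (f : EdgeL2 ℓ) :
    inner ℂ (one ℓ) f = ∫ x in (0 : ℝ)..ℓ, f x := by
  rw [inner_one, intervalIntegral.integral_of_le hℓ, integral_Icc_eq_integral_Ioc]

theorem norm_one_eq (hℓ : 0 ≤ ℓ) : ‖one ℓ‖ = √ℓ := by
  rw [one, Lp.norm_const' _ _ _ (by norm_num) (by norm_num), norm_one, one_mul, measureReal_def,
    Measure.restrict_apply_univ, Real.volume_Icc, sub_zero, ENNReal.toReal_ofReal hℓ,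
    Real.sqrt_eq_rpow]
  norm_num

theorem primitive_congr {f g : ℝ → ℂ} (h : f =ᵐ[volume.restrict (Icc 0 ℓ)] g) {x : ℝ}
    (hx : x ∈ Icc 0 ℓ) : ∫ y in (0 : ℝ)..x, f y = ∫ y in (0 : ℝ)..x, g y := by
  refine intervalIntegral.integral_congr_ae ?_
  filter_upwards [(ae_restrict_iff' measurableSet_Icc).1 h] with y hy hmem
  rw [uIoc_of_le hx.1] at hmem
  exact hy ⟨hmem.1.le, hmem.2.trans hx.2⟩

/-- Integration by parts. -/
theorem inner_volterra_add (hℓ : 0 ≤ ℓ) (f g : EdgeL2 ℓ) :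
    inner ℂ (volterra ℓ f) g + inner ℂ f (volterra ℓ g)
      = starRingEnd ℂ (inner ℂ (one ℓ) f) * inner ℂ (one ℓ) g := by
  have hd := BoundedContinuousFunction.toLp_denseRange (α := ℝ) (E := ℂ) (p := 2)
    (volume.restrict (Icc 0 ℓ)) ℂ (by norm_num)
  -- Both sides are continuous in `f` and `g`, so it is enough to treat the dense set of bounded
  -- continuous functions, whose primitives obey the classical product rule.
  refine hd.induction_on₂ (p := fun f g => inner ℂ (volterra ℓ f) g + inner ℂ f (volterra ℓ g)
      = starRingEnd ℂ (inner ℂ (one ℓ) f) * inner ℂ (one ℓ) g) ?_ ?_ f g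
  · exact isClosed_eq (by fun_prop) (by fun_prop)
  intro a b
  set fa := BoundedContinuousFunction.toLp 2 (volume.restrict (Icc 0 ℓ)) ℂ a with hfa
  set fb := BoundedContinuousFunction.toLp 2 (volume.restrict (Icc 0 ℓ)) ℂ b with hfb
  have ha : fa =ᵐ[volume.restrict (Icc 0 ℓ)] a := BoundedContinuousFunction.coeFn_toLp _ _ _ a
  have hb : fb =ᵐ[volume.restrict (Icc 0 ℓ)] b := BoundedContinuousFunction.coeFn_toLp _ _ _ b
  have hVa : volterra ℓ fa =ᵐ[volume.restrict (Icc 0 ℓ)] fun x => ∫ y in (0 : ℝ)..x, a y := by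
    filter_upwards [coeFn_volterra fa, ae_restrict_mem measurableSet_Icc] with x hx hmem
    rw [hx, primitive_congr ha hmem]
  have hVb : volterra ℓ fb =ᵐ[volume.restrict (Icc 0 ℓ)] fun x => ∫ y in (0 : ℝ)..x, b y := by
    filter_upwards [coeFn_volterra fb, ae_restrict_mem measurableSet_Icc] with x hx hmem
    rw [hx, primitive_congr hb hmem]
  have hA : ∀ x, HasDerivAt (fun x => ∫ y in (0 : ℝ)..x, a y) (a x) x := fun x =>
    intervalIntegral.integral_hasDerivAt_right (a.continuous.intervalIntegrable _ _)
      a.continuous.aestronglyMeasurable.stronglyMeasurableAtFilter a.continuous.continuousAt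
  have hB : ∀ x, HasDerivAt (fun x => ∫ y in (0 : ℝ)..x, b y) (b x) x := fun x =>
    intervalIntegral.integral_hasDerivAt_right (b.continuous.intervalIntegrable _ _)
      b.continuous.aestronglyMeasurable.stronglyMeasurableAtFilter b.continuous.continuousAt
  have hA' : ∀ x, HasDerivAt (fun x => starRingEnd ℂ (∫ y in (0 : ℝ)..x, a y))
      (starRingEnd ℂ (a x)) x := fun x => (hA x).star
  have hparts := intervalIntegral.integral_deriv_mul_eq_sub (a := 0) (b := ℓ)
    (fun x _ => hA' x) (fun x _ => hB x)
    ((Complex.continuous_conj.comp a.continuous).intervalIntegrable _ _)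
    (b.continuous.intervalIntegrable _ _)
  have h0 : ℓ ∈ Icc 0 ℓ := ⟨hℓ, le_rfl⟩
  have cA : Continuous (fun x => ∫ y in (0 : ℝ)..x, a y) :=
    continuous_iff_continuousAt.2 fun x => (hA x).continuousAt
  have cB : Continuous (fun x => ∫ y in (0 : ℝ)..x, b y) :=
    continuous_iff_continuousAt.2 fun x => (hB x).continuousAt
  have i1 : inner ℂ (volterra ℓ fa) fb
      = ∫ x in Icc 0 ℓ, starRingEnd ℂ (∫ y in (0 : ℝ)..x, a y) * b x := by
    rw [inner_eq]
    refine integral_congr_ae ?_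
    filter_upwards [hVa, hb] with x h1 h2
    rw [h1, h2]
  have i2 : inner ℂ fa (volterra ℓ fb)
      = ∫ x in Icc 0 ℓ, starRingEnd ℂ (a x) * ∫ y in (0 : ℝ)..x, b y := by
    rw [inner_eq]
    refine integral_congr_ae ?_
    filter_upwards [hVb, ha] with x h1 h2
    rw [h1, h2]
  rw [i1, i2, inner_one_eq hℓ, inner_one_eq hℓ, primitive_congr ha h0, primitive_congr hb h0,
    ← integral_add, integral_Icc_eq_integral_Ioc, ← intervalIntegral.integral_of_le hℓ]
  · simp only [intervalIntegral.integral_same, mul_zero, sub_zero] at hparts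
    rw [← hparts]
    refine intervalIntegral.integral_congr fun x _ => ?_
    ring
  · exact ((Complex.continuous_conj.comp cA).mul b.continuous).continuousOn.integrableOn_Icc
  · exact ((Complex.continuous_conj.comp a.continuous).mul cB).continuousOn.integrableOn_Icc

end EdgeL2


/-! ### Weak derivatives, primitives and compactness on an edge -/

namespace EdgeL2

variable {ℓ : ℝ}

/-- A smooth function supported inside an interval whose integral vanishes is the derivative of
a smooth function supported inside the interval. -/
theorem exists_test_primitive {θ : ℝ → ℝ} (hθ : ContDiff ℝ ∞ θ) (hc : HasCompactSupport θ)
    (hs : tsupport θ ⊆ Ioo 0 ℓ) (h0 : ∫ x, θ x = 0) :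
    ∃ φ : ℝ → ℝ, ContDiff ℝ ∞ φ ∧ HasCompactSupport φ ∧ tsupport φ ⊆ Ioo 0 ℓ ∧ deriv φ = θ := by
  rcases (tsupport θ).eq_empty_or_nonempty with he | hne
  · have hz : θ = 0 := tsupport_eq_empty_iff.1 he
    exact ⟨0, contDiff_const, HasCompactSupport.zero, by simp, by rw [hz]; simp⟩
  have hcomp : IsCompact (tsupport θ) := hc
  obtain ⟨a, ha⟩ := hcomp.exists_isLeast hne
  obtain ⟨b, hb⟩ := hcomp.exists_isGreatest hne
  have hsub : tsupport θ ⊆ Icc a b := fun x hx => ⟨ha.2 hx, hb.2 hx⟩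
  have hderiv : ∀ x, HasDerivAt (fun x => ∫ y in a..x, θ y) (θ x) x := fun x =>
    intervalIntegral.integral_hasDerivAt_right (hθ.continuous.intervalIntegrable _ _)
      hθ.continuous.aestronglyMeasurable.stronglyMeasurableAtFilter hθ.continuous.continuousAt
  have hd : deriv (fun x => ∫ y in a..x, θ y) = θ := funext fun x => (hderiv x).deriv
  have hzero : ∀ x, x ∉ Icc a b → θ x = 0 := fun x hx =>
    image_eq_zero_of_notMem_tsupport fun h => hx (hsub h)
  -- Left of `a` nothing has been integrated; right of `b` the primitive equals the full integral,
  -- which vanishes by `h0`.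
  have hsupp : Function.support (fun x => ∫ y in a..x, θ y) ⊆ Icc a b := by
    intro x hx
    by_contra hxn
    refine hx ?_
    simp only
    rcases lt_or_ge x a with h | h
    · rw [intervalIntegral.integral_symm, intervalIntegral.integral_of_le h.le,
        integral_Ioc_eq_integral_Ioo, setIntegral_eq_zero_of_forall_eq_zero, neg_zero]
      exact fun y hy => hzero y fun hy' => absurd hy.2 (not_lt.2 hy'.1)
    · have hbx : b < x := by
        by_contra hle
        exact hxn ⟨h, not_lt.1 hle⟩
      rw [intervalIntegral.integral_of_le h, ← integral_Icc_eq_integral_Ioc,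
        setIntegral_eq_integral_of_forall_compl_eq_zero, h0]
      exact fun y hy => hzero y fun hy' => hy ⟨hy'.1, hy'.2.trans hbx.le⟩
  have hts : tsupport (fun x => ∫ y in a..x, θ y) ⊆ Icc a b :=
    closure_minimal hsupp isClosed_Icc
  refine ⟨fun x => ∫ y in a..x, θ y, ?_, ?_, ?_, hd⟩
  · exact contDiff_infty_iff_deriv.2 ⟨fun x => (hderiv x).differentiableAt, by rwa [hd]⟩
  · exact isCompact_Icc.of_isClosed_subset (isClosed_tsupport _) hts
  · exact hts.trans fun x hx => ⟨(hs ha.1).1.trans_le hx.1, hx.2.trans_lt (hs hb.1).2⟩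

/-- The lemma of du Bois-Reymond. -/
theorem ae_eq_const_of_hasWeakDeriv_zero (hℓ : 0 < ℓ) {U : ℝ → ℂ}
    (hU : IntegrableOn U (Icc 0 ℓ)) (h : HasWeakDeriv ℓ U 0) :
    ∃ c : ℂ, U =ᵐ[volume.restrict (Icc 0 ℓ)] fun _ => c := by
  let B : ContDiffBump (ℓ / 2) := ⟨ℓ / 8, ℓ / 4, by positivity, by linarith⟩
  set ψ := B.normed volume with hψ
  have hψs : ContDiff ℝ ∞ ψ := B.contDiff_normed
  have hψc : HasCompactSupport ψ := B.hasCompactSupport_normed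
  have hψt : tsupport ψ ⊆ Ioo 0 ℓ := by
    rw [hψ, B.tsupport_normed_eq, Real.closedBall_eq_Icc]
    intro x hx
    have h1 : ℓ / 2 - ℓ / 4 ≤ x := hx.1
    have h2 : x ≤ ℓ / 2 + ℓ / 4 := hx.2
    exact ⟨by linarith, by linarith⟩
  refine ⟨∫ x in Icc 0 ℓ, ψ x • U x, ?_⟩
  set c := ∫ x in Icc 0 ℓ, ψ x • U x with hc
  have hUc : IntegrableOn (fun x => U x - c) (Icc 0 ℓ) := hU.sub continuousOn_const.integrableOn_Icc
  have key := IsOpen.ae_eq_zero_of_integral_contDiff_smul_eq_zero (μ := volume)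
    (f := fun x => U x - c) (isOpen_Ioo (a := (0 : ℝ)) (b := ℓ))
    (hUc.mono_set Ioo_subset_Icc_self).locallyIntegrableOn ?_
  · rw [← Measure.restrict_congr_set (Ioo_ae_eq_Icc (μ := volume) (a := (0 : ℝ)) (b := ℓ))]
    exact (ae_restrict_iff' measurableSet_Ioo).2 (key.mono fun x hx hmem =>
      sub_eq_zero.1 (hx hmem))
  intro φ hφ hφc hφt
  have hout : ∀ {χ : ℝ → ℝ}, tsupport χ ⊆ Ioo 0 ℓ → ∀ x, x ∉ Icc 0 ℓ → χ x = 0 := fun hχ x hx =>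
    image_eq_zero_of_notMem_tsupport fun h => hx (Ioo_subset_Icc_self (hχ h))
  set I := ∫ x, φ x with hI
  -- Since `ψ` has integral one, subtracting `I * ψ` makes the integral of `φ` zero. The difference
  -- is therefore the derivative of a test function, against which `U` integrates to zero.
  obtain ⟨Θ, hΘ, hΘc, hΘt, hΘd⟩ := exists_test_primitive (θ := fun x => φ x - I * ψ x) (ℓ := ℓ)
    (hφ.sub (contDiff_const.mul hψs)) (hφc.sub (hψc.mul_left (f := fun _ => I)))
    ((tsupport_sub φ (fun x => I * ψ x)).trans (union_subset hφt
      ((tsupport_mul_subset_right (f := fun _ => I) (g := ψ)).trans hψt)))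
    (by
      rw [integral_sub (hφ.continuous.integrable_of_hasCompactSupport hφc)
        ((hψs.continuous.integrable_of_hasCompactSupport hψc).const_mul I), integral_const_mul,
        hψ, B.integral_normed, mul_one, ← hI, sub_self])
  have h1 := h Θ hΘ hΘc hΘt
  rw [hΘd] at h1
  simp only [Pi.zero_apply, smul_zero, integral_zero, neg_zero, sub_smul, mul_smul] at h1
  have hint : Integrable (fun x => I • ψ x • U x) (volume.restrict (Icc 0 ℓ)) :=
    Integrable.smul I (integrable_test_smul hψs.continuous hψc hU)
  rw [integral_sub (integrable_test_smul hφ.continuous hφc hU) hint, integral_smul, ← hc] at h1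
  have hIset : ∫ x in Icc 0 ℓ, φ x = I :=
    setIntegral_eq_integral_of_forall_compl_eq_zero (hout hφt)
  rw [← setIntegral_eq_integral_of_forall_compl_eq_zero (s := Icc 0 ℓ)
    (fun x hx => by rw [hout hφt x hx, zero_smul])]
  simp only [smul_sub]
  rw [integral_sub (integrable_test_smul hφ.continuous hφc hU)
    (integrable_test_smul hφ.continuous hφc continuousOn_const.integrableOn_Icc), integral_smul_const, hIset]
  exact h1

/-- The class of a function that is continuous on `[0, ℓ]`. -/
def ofContinuousOn {u : ℝ → ℂ} (hu : ContinuousOn u (Icc 0 ℓ)) : EdgeL2 ℓ :=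
  (memLp_of_continuousOn hu).toLp u

theorem coeFn_ofContinuousOn {u : ℝ → ℂ} (hu : ContinuousOn u (Icc 0 ℓ)) :
    ofContinuousOn hu =ᵐ[volume.restrict (Icc 0 ℓ)] u :=
  MemLp.coeFn_toLp _

theorem continuousOn_add_primitive (a : ℂ) (w : EdgeL2 ℓ) :
    ContinuousOn (fun x => a + ∫ y in (0 : ℝ)..x, w y) (Icc 0 ℓ) :=
  continuousOn_const.add w.continuousOn_primitive

theorem coeFn_smul_one_add_volterra (a : ℂ) (w : EdgeL2 ℓ) :
    (a • one ℓ + volterra ℓ w : EdgeL2 ℓ) =ᵐ[volume.restrict (Icc 0 ℓ)]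
      fun x => a + ∫ y in (0 : ℝ)..x, w y := by
  filter_upwards [Lp.coeFn_add (a • one ℓ) (volterra ℓ w), Lp.coeFn_smul a (one ℓ), coeFn_one,
    coeFn_volterra w] with x h1 h2 h3 h4
  rw [h1, Pi.add_apply, h2, Pi.smul_apply, h3, h4, smul_eq_mul, mul_one]

/-- A test function is the primitive of its own derivative `D`, so this is `inner_volterra_add` with
`f = D`; the boundary term disappears because `D` has mean zero. -/
theorem hasWeakDeriv_primitive (hℓ : 0 ≤ ℓ) (a : ℂ) (w : EdgeL2 ℓ) :
    HasWeakDeriv ℓ (fun x => a + ∫ y in (0 : ℝ)..x, w y) w := by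
  intro φ hφ hc hs
  have hd : Continuous (deriv φ) := hφ.continuous_deriv (by simp)
  have hdc : ContinuousOn (fun x => ((deriv φ x : ℝ) : ℂ)) (Icc 0 ℓ) :=
    (Complex.continuous_ofReal.comp hd).continuousOn
  set D := ofContinuousOn hdc with hD
  have hDae := coeFn_ofContinuousOn hdc
  have hprim : ∀ x ∈ Icc 0 ℓ, ∫ y in (0 : ℝ)..x, D y = ((φ x : ℝ) : ℂ) := by
    intro x hx
    rw [primitive_congr hDae hx, intervalIntegral.integral_ofReal,
      intervalIntegral.integral_deriv_eq_sub (fun y _ => (hφ.differentiable (by simp)) y)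
        (hd.intervalIntegrable _ _),
      image_eq_zero_of_notMem_tsupport (x := 0) (f := φ) fun h => lt_irrefl _ (hs h).1, sub_zero]
  have hφℓ : φ ℓ = 0 := image_eq_zero_of_notMem_tsupport fun h => lt_irrefl _ (hs h).2
  have hm : inner ℂ (one ℓ) D = 0 := by
    rw [inner_one_eq hℓ, hprim ℓ ⟨hℓ, le_rfl⟩, hφℓ, Complex.ofReal_zero]
  have h1 : ∫ x in Icc 0 ℓ, deriv φ x • (a + ∫ y in (0 : ℝ)..x, w y)
      = inner ℂ D (a • one ℓ + volterra ℓ w) := by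
    rw [inner_eq]
    refine integral_congr_ae ?_
    filter_upwards [hDae, coeFn_smul_one_add_volterra a w] with x h1 h2
    rw [h1, h2, Complex.conj_ofReal, Complex.real_smul]
  have h2 : ∫ x in Icc 0 ℓ, φ x • w x = inner ℂ (volterra ℓ D) w := by
    rw [inner_eq]
    refine integral_congr_ae ?_
    filter_upwards [coeFn_volterra D, ae_restrict_mem measurableSet_Icc] with x h1 h2
    rw [h1, hprim x h2, Complex.conj_ofReal, Complex.real_smul]
  have h3 := inner_volterra_add hℓ D w
  rw [hm, map_zero, zero_mul] at h3
  rw [h1, h2, inner_add_right, inner_smul_right, ← inner_conj_symm, hm, map_zero, mul_zero,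
    zero_add]
  exact eq_neg_of_add_eq_zero_right h3

theorem eqOn_of_ae_eq (hℓ : 0 < ℓ) {u v : ℝ → ℂ} (hu : ContinuousOn u (Icc 0 ℓ))
    (hv : ContinuousOn v (Icc 0 ℓ)) (h : u =ᵐ[volume.restrict (Icc 0 ℓ)] v) :
    EqOn u v (Icc 0 ℓ) :=
  Measure.eqOn_Icc_of_ae_eq volume hℓ.ne h hu hv

/-- The difference of `u` and the primitive of `w` has weak derivative zero, hence is a constant,
identified at `0`. -/
theorem eq_add_primitive_of_hasWeakDeriv (hℓ : 0 < ℓ) {u : ℝ → ℂ}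
    (hu : ContinuousOn u (Icc 0 ℓ)) {w : EdgeL2 ℓ} (h : HasWeakDeriv ℓ u w) {x : ℝ}
    (hx : x ∈ Icc 0 ℓ) : u x = u 0 + ∫ y in (0 : ℝ)..x, w y := by
  have hp := (hasWeakDeriv_primitive hℓ.le 0 w).const_smul (-1)
  have hcp : ContinuousOn (fun x => 0 + ∫ y in (0 : ℝ)..x, w y) (Icc 0 ℓ) :=
    continuousOn_add_primitive 0 w
  have h2 := h.add hp hu.integrableOn_Icc (hcp.const_smul _).integrableOn_Icc w.integrableOn
    (w.integrableOn.smul (-1 : ℂ))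
  have h3 : HasWeakDeriv ℓ (u + (-1 : ℂ) • fun x => 0 + ∫ y in (0 : ℝ)..x, w y) 0 :=
    h2.congr (Eventually.of_forall fun _ => rfl) (Eventually.of_forall fun x => by simp)
  obtain ⟨c, hc⟩ := ae_eq_const_of_hasWeakDeriv_zero hℓ
    (hu.add (hcp.const_smul (-1 : ℂ))).integrableOn_Icc h3
  have hc' := eqOn_of_ae_eq hℓ (hu.add (hcp.const_smul (-1 : ℂ))) continuousOn_const hc
  have e1 := hc' hx
  have e2 := hc' (left_mem_Icc.2 hℓ.le)
  simp only [Pi.add_apply, Pi.smul_apply, smul_eq_mul, intervalIntegral.integral_same] at e1 e2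
  linear_combination e1 - e2

theorem eq_zero_of_primitive_eq_zero (hℓ : 0 < ℓ) {f : EdgeL2 ℓ}
    (h : ∀ x ∈ Icc 0 ℓ, ∫ y in (0 : ℝ)..x, f y = 0) : f = 0 := by
  have h1 := (hasWeakDeriv_primitive hℓ.le 0 f).ae_eq_zero
    ((ae_restrict_iff' measurableSet_Icc).2 (Eventually.of_forall fun x hx => by
      simp [h x hx])) f.integrableOn
  exact Lp.ext (h1.trans (Lp.coeFn_zero _ _ _).symm)

/-- The continuous representative takes the value `a` at `0`, so `a` vanishes, and then so does
every integral of `f`. Injectivity of the embedding of the form domain and density of its range rest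
on this. -/
theorem eq_zero_of_smul_one_add_volterra (hℓ : 0 < ℓ) {a : ℂ} {f : EdgeL2 ℓ}
    (h : a • one ℓ + volterra ℓ f = 0) : a = 0 ∧ f = 0 := by
  have h1 : (fun x => a + ∫ y in (0 : ℝ)..x, f y) =ᵐ[volume.restrict (Icc 0 ℓ)] fun _ => 0 := by
    refine (coeFn_smul_one_add_volterra a f).symm.trans ?_
    rw [h]
    exact Lp.coeFn_zero _ _ _
  have h2 := eqOn_of_ae_eq hℓ (continuousOn_add_primitive a f) continuousOn_const h1
  have ha : a = 0 := by simpa using h2 (left_mem_Icc.2 hℓ.le)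
  refine ⟨ha, eq_zero_of_primitive_eq_zero hℓ fun x hx => ?_⟩
  simpa [ha] using h2 hx

/-- `volterra` is injective but misses the constant function, which is impossible for an
endomorphism in finite dimension. -/
theorem not_finiteDimensional (hℓ : 0 < ℓ) : ¬ FiniteDimensional ℂ (EdgeL2 ℓ) := by
  intro hfin
  have hinj : Function.Injective (volterra ℓ : EdgeL2 ℓ →ₗ[ℂ] EdgeL2 ℓ) := by
    refine (injective_iff_map_eq_zero _).2 fun f hf => ?_
    exact (eq_zero_of_smul_one_add_volterra hℓ (a := 0) (f := f)
      (by rw [zero_smul, zero_add]; exact hf)).2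
  obtain ⟨f, hf⟩ := (LinearMap.injective_iff_surjective.1 hinj) (one ℓ)
  have h1 := eq_zero_of_smul_one_add_volterra hℓ (a := -1) (f := f) (by
    rw [show volterra ℓ f = one ℓ from hf]; simp)
  simpa using h1.1

/-- Integration is a compact operator. -/
theorem isCompactOperator_volterra (hℓ : 0 ≤ ℓ) : IsCompactOperator (volterra ℓ) := by
  -- `volterra` factors through continuous functions on `[0, ℓ]`: `P` takes the primitive, `Q`
  -- extends it by constants to the line, `L` passes to classes. `P` maps the unit ball to a
  -- relatively compact set.
  let P : EdgeL2 ℓ → BoundedContinuousFunction (Icc (0 : ℝ) ℓ) ℂ := fun f =>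
    BoundedContinuousFunction.mkOfCompact
      ⟨fun x => ∫ y in (0 : ℝ)..x, f y, continuousOn_iff_continuous_domRestrict.1
        f.continuousOn_primitive⟩
  let Q : BoundedContinuousFunction (Icc (0 : ℝ) ℓ) ℂ → BoundedContinuousFunction ℝ ℂ := fun c =>
    c.compContinuous ⟨projIcc 0 ℓ hℓ, continuous_projIcc⟩
  have hQ : Continuous Q := BoundedContinuousFunction.continuous_compContinuous _
  let L := BoundedContinuousFunction.toLp (α := ℝ) (E := ℂ) 2 (volume.restrict (Icc 0 ℓ)) ℂ
  have hfac : ∀ f, volterra ℓ f = L (Q (P f)) := by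
    intro f
    refine Lp.ext ?_
    filter_upwards [coeFn_volterra f,
      BoundedContinuousFunction.coeFn_toLp 2 (volume.restrict (Icc 0 ℓ)) ℂ (Q (P f)),
      ae_restrict_mem measurableSet_Icc] with x h1 h2 h3
    rw [h1, h2]
    simp only [Q, P, BoundedContinuousFunction.compContinuous_apply, ContinuousMap.coe_mk,
      projIcc_of_mem hℓ h3]
    rfl
  have hcomp : IsCompact (closure (P '' Metric.ball 0 1)) := by
    refine BoundedContinuousFunction.arzela_ascoli (Metric.closedBall (0 : ℂ) (√ℓ))
      (isCompact_closedBall _ _) _ ?_ ?_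
    · rintro _ x ⟨f, hf, rfl⟩
      rw [mem_closedBall_zero_iff]
      refine (f.norm_primitive_le x.2).trans ?_
      rw [mem_ball_zero_iff] at hf
      exact mul_le_of_le_one_right (Real.sqrt_nonneg _) hf.le
    · refine Metric.equicontinuous_of_continuity_modulus (fun d => √d) ?_ _ ?_
      · have := Real.continuous_sqrt.tendsto 0
        rwa [Real.sqrt_zero] at this
      · rintro x y ⟨_, f, hf, rfl⟩
        rw [mem_ball_zero_iff] at hf
        have h0 : (0 : ℝ) ∈ Icc 0 ℓ := ⟨le_rfl, hℓ⟩
        have h1 := f.norm_integral_le x.2 y.2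
        rw [dist_comm, Complex.dist_eq, Subtype.dist_eq, Real.dist_eq, abs_sub_comm]
        have h2 : (∫ z in (0 : ℝ)..y, f z) - (∫ z in (0 : ℝ)..x, f z) = ∫ z in (x : ℝ)..y, f z :=
          intervalIntegral.integral_interval_sub_left (f.intervalIntegrable h0 y.2)
            (f.intervalIntegrable h0 x.2)
        refine (le_of_eq (congrArg norm h2)).trans (h1.trans ?_)
        exact mul_le_of_le_one_right (Real.sqrt_nonneg _) hf.le
  refine (isCompactOperator_iff_image_ball_subset_compact (volterra ℓ : EdgeL2 ℓ →ₗ[ℂ] EdgeL2 ℓ)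
    one_pos).2 ⟨(L ∘ Q) '' closure (P '' Metric.ball 0 1), hcomp.image (L.continuous.comp hQ), ?_⟩
  rintro _ ⟨f, hf, rfl⟩
  exact ⟨P f, subset_closure ⟨f, hf, rfl⟩, (hfac f).symm⟩

end EdgeL2


/-! ### The form domain and the trace inequality -/

namespace MetricGraph

variable {V E : Type*} [Fintype E]

open EdgeL2

/-- The form domain: the pairs of the vertex values and the edgewise derivative of a function of
class `W^{1,2}` on the edges that is continuous at the vertices. -/
def formDomain (Γ : MetricGraph V E) : Submodule ℂ ((V → ℂ) × Γ.L2) where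
  carrier := {w | (∀ e, w.1 (Γ.tgt e) = w.1 (Γ.src e) + inner ℂ (one (Γ.length e)) (w.2 e)) ∧
    -- An isolated vertex is invisible in `L²(Γ)`; without this normalisation the embedding would
    -- have a kernel.
    ∀ v, (∀ e, Γ.src e ≠ v ∧ Γ.tgt e ≠ v) → w.1 v = 0}
  zero_mem' := by simp
  add_mem' := by
    rintro w w' ⟨h1, h2⟩ ⟨k1, k2⟩
    refine ⟨fun e => ?_, fun v hv => ?_⟩
    · simp only [Prod.fst_add, Pi.add_apply, Prod.snd_add, PiLp.add_apply, inner_add_right, h1, k1]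
      ring
    · simp [h2 v hv, k2 v hv]
  smul_mem' := by
    rintro a w ⟨h1, h2⟩
    refine ⟨fun e => ?_, fun v hv => ?_⟩
    · simp only [Prod.smul_fst, Pi.smul_apply, Prod.smul_snd, PiLp.smul_apply, inner_smul_right, h1,
        smul_eq_mul]
      ring
    · simp [h2 v hv]

/-- The value at `v` of a function in the form domain. -/
def trace (Γ : MetricGraph V E) (v : V) : Γ.formDomain →L[ℂ] ℂ :=
  ((ContinuousLinearMap.proj v).comp (ContinuousLinearMap.fst ℂ (V → ℂ) Γ.L2)).comp
    Γ.formDomain.subtypeL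

/-- The derivative of a function in the form domain. -/
def derivative (Γ : MetricGraph V E) : Γ.formDomain →L[ℂ] Γ.L2 :=
  (ContinuousLinearMap.snd ℂ (V → ℂ) Γ.L2).comp Γ.formDomain.subtypeL

/-- The restriction to an edge of a function in the form domain, as an element of `L²`. -/
def edgeEmbedding (Γ : MetricGraph V E) (e : E) : Γ.formDomain →L[ℂ] EdgeL2 (Γ.length e) :=
  (ContinuousLinearMap.toSpanSingleton ℂ (one (Γ.length e))).comp (Γ.trace (Γ.src e)) +
    ((volterra (Γ.length e)).comp (PiLp.proj 2 _ e)).comp Γ.derivative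

/-- The embedding of the form domain into `L²(Γ)`. -/
def embedding (Γ : MetricGraph V E) : Γ.formDomain →L[ℂ] Γ.L2 :=
  ((PiLp.continuousLinearEquiv 2 ℂ fun e : E => EdgeL2 (Γ.length e)).symm :
    (∀ e, EdgeL2 (Γ.length e)) →L[ℂ] Γ.L2).comp (ContinuousLinearMap.pi Γ.edgeEmbedding)

variable {Γ : MetricGraph V E}

theorem embedding_apply (w : Γ.formDomain) (e : E) :
    Γ.embedding w e = Γ.trace (Γ.src e) w • one (Γ.length e)
      + volterra (Γ.length e) (Γ.derivative w e) := rfl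

theorem trace_tgt (w : Γ.formDomain) (e : E) : Γ.trace (Γ.tgt e) w
    = Γ.trace (Γ.src e) w + inner ℂ (one (Γ.length e)) (Γ.derivative w e) := w.2.1 e

theorem trace_eq_zero (w : Γ.formDomain) {v : V} (hv : ∀ e, Γ.src e ≠ v ∧ Γ.tgt e ≠ v) :
    Γ.trace v w = 0 := w.2.2 v hv

/-- On each edge the map is a rank-one term plus `volterra` after a bounded map, and finitely many
edges preserve compactness. -/
theorem isCompactOperator_embedding (Γ : MetricGraph V E) : IsCompactOperator Γ.embedding := by
  have hedge : ∀ e, IsCompactOperator (Γ.edgeEmbedding e) := by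
    intro e
    refine IsCompactOperator.add (f := (ContinuousLinearMap.toSpanSingleton ℂ
      (one (Γ.length e))).comp (Γ.trace (Γ.src e))) ?_ ?_
    · exact (isCompactOperator_of_locallyCompactSpace_rng
        (ContinuousLinearMap.toSpanSingleton ℂ (one (Γ.length e)))).comp_clm _
    · exact ((isCompactOperator_volterra (Γ.length_pos e).le).comp_clm
        (PiLp.proj 2 (fun e => EdgeL2 (Γ.length e)) e)).comp_clm Γ.derivative
  choose K hK hKn using hedge
  have hpi : IsCompactOperator (ContinuousLinearMap.pi Γ.edgeEmbedding) := by
    refine ⟨Set.pi univ K, isCompact_univ_pi hK, ?_⟩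
    filter_upwards [Filter.iInter_mem.2 hKn] with w hw e _
    exact mem_iInter.1 hw e
  exact hpi.clm_comp ((PiLp.continuousLinearEquiv 2 ℂ fun e : E => EdgeL2 (Γ.length e)).symm :
    (∀ e, EdgeL2 (Γ.length e)) →L[ℂ] Γ.L2)

instance : CompleteSpace Γ.formDomain := by
  have hcl : IsClosed (Γ.formDomain : Set ((V → ℂ) × Γ.L2)) := by
    have : (Γ.formDomain : Set ((V → ℂ) × Γ.L2)) =
        (⋂ e, {w | w.1 (Γ.tgt e) = w.1 (Γ.src e) + inner ℂ (one (Γ.length e)) (w.2 e)}) ∩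
        ⋂ v, ⋂ (_ : ∀ e, Γ.src e ≠ v ∧ Γ.tgt e ≠ v), {w | w.1 v = 0} := by
      ext w
      simp [formDomain]
    rw [this]
    refine IsClosed.inter (isClosed_iInter fun e => ?_)
      (isClosed_iInter fun v => isClosed_iInter fun _ => ?_)
    · exact isClosed_eq (by fun_prop) (by fun_prop)
    · exact isClosed_eq (by fun_prop) (by fun_prop)
  exact hcl.completeSpace_coe

/-- The quadratic form of the operator with parameter `σ`. -/
def robinForm (Γ : MetricGraph V E) (R : Finset V) (σ : ℝ) :
    Γ.formDomain →ₗ⋆[ℂ] Γ.formDomain →ₗ[ℂ] ℂ :=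
  LinearMap.mk₂'ₛₗ _ _ (fun w w' => inner ℂ (Γ.derivative w) (Γ.derivative w')
      + σ * ∑ v ∈ R, starRingEnd ℂ (Γ.trace v w) * Γ.trace v w')
    (fun w₁ w₂ w' => by
      simp only [map_add, inner_add_left, add_mul, Finset.sum_add_distrib]
      ring)
    (fun a w w' => by
      simp only [map_smul, inner_smul_left, smul_eq_mul, map_mul, mul_assoc, ← Finset.mul_sum]
      ring)
    (fun w w₁ w₂ => by
      simp only [map_add, inner_add_right, mul_add, Finset.sum_add_distrib]
      ring)
    (fun a w w' => by
      simp only [map_smul, inner_smul_right, smul_eq_mul, RingHom.id_apply, mul_left_comm _ a,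
        ← Finset.mul_sum]
      ring)

theorem robinForm_apply (R : Finset V) (σ : ℝ) (w w' : Γ.formDomain) :
    Γ.robinForm R σ w w' = inner ℂ (Γ.derivative w) (Γ.derivative w')
      + σ * ∑ v ∈ R, starRingEnd ℂ (Γ.trace v w) * Γ.trace v w' := rfl

theorem robinForm_conj (R : Finset V) (σ : ℝ) (w w' : Γ.formDomain) :
    Γ.robinForm R σ w' w = starRingEnd ℂ (Γ.robinForm R σ w w') := by
  simp only [robinForm_apply, map_add, map_mul, map_sum, Complex.conj_conj, Complex.conj_ofReal,
    inner_conj_symm, mul_comm]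

/-- The sum of the squares of the values at the vertices of `R`. -/
def boundaryForm (Γ : MetricGraph V E) (R : Finset V) (w : Γ.formDomain) : ℝ :=
  ∑ v ∈ R, ‖Γ.trace v w‖ ^ 2

theorem boundaryForm_nonneg (R : Finset V) (w : Γ.formDomain) : 0 ≤ Γ.boundaryForm R w :=
  Finset.sum_nonneg fun _ _ => by positivity

theorem re_robinForm (R : Finset V) (σ : ℝ) (w : Γ.formDomain) :
    (Γ.robinForm R σ w w).re = ‖Γ.derivative w‖ ^ 2 + σ * Γ.boundaryForm R w := by
  rw [robinForm_apply, Complex.add_re, Complex.re_ofReal_mul, Complex.re_sum, boundaryForm]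
  congr 1
  · exact inner_self_eq_norm_sq (𝕜 := ℂ) _
  · congr 1
    refine Finset.sum_congr rfl fun v _ => ?_
    rw [← Complex.normSq_eq_conj_mul_self, Complex.ofReal_re, Complex.normSq_eq_norm_sq]

theorem eq_zero_of_embedding_eq_zero [Fintype V] {w : Γ.formDomain} (h : Γ.embedding w = 0) :
    w = 0 := by
  have hedge : ∀ e, Γ.trace (Γ.src e) w = 0 ∧ Γ.derivative w e = 0 := fun e =>
    eq_zero_of_smul_one_add_volterra (Γ.length_pos e) (by
      rw [← embedding_apply, h]; rfl)
  have hd : Γ.derivative w = 0 := by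
    ext1 e
    exact (hedge e).2
  have ht : ∀ v, Γ.trace v w = 0 := by
    intro v
    by_cases hv : ∀ e, Γ.src e ≠ v ∧ Γ.tgt e ≠ v
    · exact trace_eq_zero w hv
    · push Not at hv
      obtain ⟨e, he⟩ := hv
      by_cases hs : Γ.src e = v
      · rw [← hs]; exact (hedge e).1
      · rw [← he hs, trace_tgt, (hedge e).1, hd]
        simp
  exact Subtype.ext (Prod.ext (funext ht) hd)

/-- The trace inequality. -/
theorem exists_norm_trace_le [Fintype V] (Γ : MetricGraph V E) :
    ∃ K : ℝ, 0 ≤ K ∧ ∀ (v : V) (w : Γ.formDomain),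
      ‖Γ.trace v w‖ ≤ K * (‖Γ.embedding w‖ + ‖Γ.derivative w‖) := by
  have hsrc : ∀ e, ∃ K : ℝ, 0 ≤ K ∧ ∀ w : Γ.formDomain,
      ‖Γ.trace (Γ.src e) w‖ ≤ K * (‖Γ.embedding w‖ + ‖Γ.derivative w‖) := by
    intro e
    have hs : 0 < √(Γ.length e) := Real.sqrt_pos.2 (Γ.length_pos e)
    refine ⟨(1 + ‖volterra (Γ.length e)‖) / √(Γ.length e), by positivity, fun w => ?_⟩
    -- The value at the left end is the function minus the primitive of its derivative, a constant
    -- function of norm `|value| * √ℓ`.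
    have h1 : Γ.trace (Γ.src e) w • one (Γ.length e)
        = Γ.embedding w e - volterra (Γ.length e) (Γ.derivative w e) := by
      rw [embedding_apply]; abel
    have h2 : ‖Γ.trace (Γ.src e) w‖ * √(Γ.length e)
        ≤ ‖Γ.embedding w‖ + ‖volterra (Γ.length e)‖ * ‖Γ.derivative w‖ := by
      rw [← norm_one_eq (Γ.length_pos e).le, ← norm_smul, h1]
      refine (norm_sub_le _ _).trans (add_le_add (PiLp.norm_apply_le _ e) ?_)
      refine ((volterra (Γ.length e)).le_opNorm _).trans ?_
      gcongr
      exact PiLp.norm_apply_le _ e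
    rw [div_mul_eq_mul_div, le_div_iff₀ hs]
    refine h2.trans ?_
    nlinarith [norm_nonneg (Γ.embedding w), norm_nonneg (Γ.derivative w),
      norm_nonneg (volterra (Γ.length e)),
      mul_nonneg (norm_nonneg (volterra (Γ.length e))) (norm_nonneg (Γ.embedding w))]
  have hv : ∀ v, ∃ K : ℝ, 0 ≤ K ∧ ∀ w : Γ.formDomain,
      ‖Γ.trace v w‖ ≤ K * (‖Γ.embedding w‖ + ‖Γ.derivative w‖) := by
    intro v
    by_cases hv : ∀ e, Γ.src e ≠ v ∧ Γ.tgt e ≠ v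
    · exact ⟨0, le_rfl, fun w => by simp [trace_eq_zero w hv]⟩
    · push Not at hv
      obtain ⟨e, he⟩ := hv
      obtain ⟨K, hK, hle⟩ := hsrc e
      by_cases hs : Γ.src e = v
      · rw [← hs]; exact ⟨K, hK, hle⟩
      · refine ⟨K + √(Γ.length e), by positivity, fun w => ?_⟩
        rw [← he hs, trace_tgt, add_mul]
        refine (norm_add_le _ _).trans (add_le_add (hle w) ?_)
        refine (norm_inner_le_norm _ _).trans ?_
        rw [norm_one_eq (Γ.length_pos e).le]
        gcongr
        exact (PiLp.norm_apply_le _ e).trans (le_add_of_nonneg_left (norm_nonneg _))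
  choose K hK hle using hv
  refine ⟨∑ v, K v, Finset.sum_nonneg fun v _ => hK v, fun v w => (hle v w).trans ?_⟩
  gcongr
  exact Finset.single_le_sum (f := K) (fun v _ => hK v) (Finset.mem_univ v)

theorem exists_boundaryForm_le [Fintype V] (Γ : MetricGraph V E) (R : Finset V) :
    ∃ K : ℝ, 0 ≤ K ∧ ∀ w : Γ.formDomain,
      Γ.boundaryForm R w ≤ K * (‖Γ.embedding w‖ ^ 2 + ‖Γ.derivative w‖ ^ 2) := by
  obtain ⟨K, hK, hle⟩ := Γ.exists_norm_trace_le
  refine ⟨R.card * (K ^ 2 * 2), by positivity, fun w => ?_⟩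
  rw [boundaryForm, mul_assoc, ← nsmul_eq_mul]
  refine Finset.sum_le_card_nsmul _ _ _ fun v _ => ?_
  calc ‖Γ.trace v w‖ ^ 2 ≤ (K * (‖Γ.embedding w‖ + ‖Γ.derivative w‖)) ^ 2 := by
        gcongr; exact hle v w
    _ = K ^ 2 * (‖Γ.embedding w‖ + ‖Γ.derivative w‖) ^ 2 := by ring
    _ ≤ K ^ 2 * (2 * (‖Γ.embedding w‖ ^ 2 + ‖Γ.derivative w‖ ^ 2)) := by
        gcongr; exact add_sq_le
    _ = _ := by ring

end MetricGraph


/-! ### Green's formula and the weak form of the operator -/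

namespace EdgeL2

/-- The component of `x` orthogonal to the constants has mean zero, hence is orthogonal to `x` and
so to itself. -/
theorem exists_eq_smul_one {ℓ : ℝ} (hℓ : 0 < ℓ) {x : EdgeL2 ℓ}
    (h : ∀ k : EdgeL2 ℓ, inner ℂ (one ℓ) k = 0 → inner ℂ x k = 0) : ∃ a : ℂ, x = a • one ℓ := by
  have hne : inner ℂ (one ℓ) (one ℓ) ≠ 0 := by
    rw [Ne, inner_self_eq_zero, ← norm_eq_zero, norm_one_eq hℓ.le]
    exact (Real.sqrt_pos.2 hℓ).ne'
  set a := inner ℂ (one ℓ) x / inner ℂ (one ℓ) (one ℓ) with ha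
  have h1 : inner ℂ (one ℓ) (x - a • one ℓ) = 0 := by
    rw [inner_sub_right, inner_smul_right, ha, div_mul_cancel₀ _ hne, sub_self]
  refine ⟨a, sub_eq_zero.1 (inner_self_eq_zero (𝕜 := ℂ) |>.1 ?_)⟩
  rw [inner_sub_left, h _ h1, inner_smul_left, h1, mul_zero, sub_zero]

end EdgeL2

namespace MetricGraph

open EdgeL2

variable {V E : Type*} [Fintype E] {Γ : MetricGraph V E}

theorem sum_fiber [Fintype V] [DecidableEq V] (p : E → V) (F : E → ℂ) (c : V → ℂ) :
    ∑ e, F e * c (p e) = ∑ v, (∑ e with p e = v, F e) * c v := by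
  rw [← Finset.sum_fiberwise Finset.univ p]
  refine Finset.sum_congr rfl fun v _ => ?_
  rw [Finset.sum_mul]
  refine Finset.sum_congr rfl fun e he => ?_
  rw [(Finset.mem_filter.1 he).2]

/-- The total current out of `v` for the derivatives `b` at the left ends and the second
derivatives `-g`. -/
def current [DecidableEq V] (Γ : MetricGraph V E) (b : E → ℂ) (g : Γ.L2) (v : V) : ℂ :=
  (∑ e with Γ.src e = v, b e)
    - ∑ e with Γ.tgt e = v, (b e - inner ℂ (one (Γ.length e)) (g e))

/-- Green's formula: integration by parts on every edge, with the boundary terms regrouped by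
vertex. -/
theorem inner_derivative_sub [Fintype V] [DecidableEq V] {w : Γ.formDomain} {g : Γ.L2} {b : E → ℂ}
    (hb : ∀ e, Γ.derivative w e = b e • one (Γ.length e) - volterra (Γ.length e) (g e))
    (w' : Γ.formDomain) :
    inner ℂ (Γ.derivative w) (Γ.derivative w') - inner ℂ g (Γ.embedding w')
      = - ∑ v, starRingEnd ℂ (Γ.current b g v) * Γ.trace v w' := by
  have h1 : ∀ e, inner ℂ (Γ.derivative w e) (Γ.derivative w' e) - inner ℂ (g e) (Γ.embedding w' e)
      = starRingEnd ℂ (b e - inner ℂ (one (Γ.length e)) (g e)) * Γ.trace (Γ.tgt e) w'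
        - starRingEnd ℂ (b e) * Γ.trace (Γ.src e) w' := by
    intro e
    have h2 := inner_volterra_add (Γ.length_pos e).le (g e) (Γ.derivative w' e)
    have h3 := trace_tgt w' e
    have h4 : inner ℂ (g e) (one (Γ.length e))
      = starRingEnd ℂ (inner ℂ (one (Γ.length e)) (g e)) := (inner_conj_symm _ _).symm
    rw [hb e, embedding_apply, inner_sub_left, inner_add_right, inner_smul_left, inner_smul_right,
      map_sub, h3, h4]
    linear_combination -h2
  rw [PiLp.inner_apply, PiLp.inner_apply, ← Finset.sum_sub_distrib]
  simp only [h1, Finset.sum_sub_distrib]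
  rw [sum_fiber Γ.tgt (fun e => starRingEnd ℂ (b e - inner ℂ (one (Γ.length e)) (g e)))
    (fun v => Γ.trace v w'), sum_fiber Γ.src (fun e => starRingEnd ℂ (b e))
    (fun v => Γ.trace v w'), ← Finset.sum_sub_distrib, ← Finset.sum_neg_distrib]
  refine Finset.sum_congr rfl fun v _ => ?_
  simp only [current, map_sub, map_sum]
  ring

/-- The vertex conditions are natural boundary conditions. Test functions vanishing at all vertices
give the equation on the edges; test functions equal to one at a single vertex then give its current
condition. The converse is Green's formula. -/
theorem robinForm_eq_iff [Fintype V] [DecidableEq V] (R : Finset V) (σ : ℝ) (w : Γ.formDomain)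
    (g : Γ.L2) :
    (∀ w', Γ.robinForm R σ w w' = inner ℂ g (Γ.embedding w')) ↔
      ∃ b : E → ℂ,
        (∀ e, Γ.derivative w e = b e • one (Γ.length e) - volterra (Γ.length e) (g e)) ∧
        ∀ v, Γ.current b g v = (if v ∈ R then (σ : ℂ) else 0) * Γ.trace v w := by
  classical
  have hsum : ∀ w' : Γ.formDomain,
      (σ : ℂ) * ∑ v ∈ R, starRingEnd ℂ (Γ.trace v w) * Γ.trace v w'
      = ∑ v, starRingEnd ℂ ((if v ∈ R then (σ : ℂ) else 0) * Γ.trace v w) * Γ.trace v w' := by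
    intro w'
    rw [Finset.mul_sum, ← Finset.sum_subset (Finset.subset_univ R)]
    · refine Finset.sum_congr rfl fun v hv => ?_
      rw [if_pos hv, map_mul, Complex.conj_ofReal, mul_assoc]
    · intro v _ hv
      rw [if_neg hv, zero_mul, map_zero, zero_mul]
  constructor
  · intro h
    have hb : ∀ e, ∃ a : ℂ, Γ.derivative w e + volterra (Γ.length e) (g e)
        = a • one (Γ.length e) := by
      intro e
      refine exists_eq_smul_one (Γ.length_pos e) fun k hk => ?_
      let w' : Γ.formDomain := ⟨(0, PiLp.single 2 e k), fun e' => by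
        rcases eq_or_ne e' e with rfl | he
        · simp [hk]
        · simp [he], fun v _ => rfl⟩
      have h1 := h w'
      have hd : Γ.derivative w' = PiLp.single 2 e k := rfl
      have ht : ∀ v, Γ.trace v w' = 0 := fun v => rfl
      have hin : ∀ f : Γ.L2, inner ℂ f (Γ.derivative w') = inner ℂ (f e) k := by
        intro f
        rw [PiLp.inner_apply, Finset.sum_eq_single e]
        · simp [hd]
        · intro e' _ he'
          simp [hd, he']
        · simp
      have hJ : inner ℂ g (Γ.embedding w') = inner ℂ (g e) (volterra (Γ.length e) k) := by
        rw [PiLp.inner_apply, Finset.sum_eq_single e]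
        · rw [embedding_apply, ht, hd]
          simp
        · intro e' _ he'
          rw [embedding_apply, ht, hd]
          simp [he']
        · simp
      have h2 := inner_volterra_add (Γ.length_pos e).le (g e) k
      rw [robinForm_apply, hJ, hin] at h1
      simp only [ht, mul_zero, Finset.sum_const_zero, add_zero] at h1
      rw [inner_add_left, h1, add_comm, h2, hk, mul_zero]
    choose b hb using hb
    have hb' : ∀ e, Γ.derivative w e = b e • one (Γ.length e) - volterra (Γ.length e) (g e) :=
      fun e => eq_sub_of_add_eq (hb e)
    refine ⟨b, hb', fun v => ?_⟩
    by_cases hv : ∀ e, Γ.src e ≠ v ∧ Γ.tgt e ≠ v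
    · rw [trace_eq_zero w hv, mul_zero, current, Finset.sum_eq_zero, Finset.sum_eq_zero, sub_zero]
      · exact fun e he => absurd (Finset.mem_filter.1 he).2 (hv e).2
      · exact fun e he => absurd (Finset.mem_filter.1 he).2 (hv e).1
    · let c : V → ℂ := Pi.single v 1
      -- The test function that is affine on every edge, equal to `1` at `v` and to `0` at the other
      -- vertices.
      let w' : Γ.formDomain := ⟨(c, WithLp.toLp 2 fun e =>
        ((c (Γ.tgt e) - c (Γ.src e)) / inner ℂ (one (Γ.length e)) (one (Γ.length e)))
          • one (Γ.length e)), fun e => by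
          have hne : inner ℂ (one (Γ.length e)) (one (Γ.length e)) ≠ 0 := by
            rw [Ne, inner_self_eq_zero, ← norm_eq_zero, norm_one_eq (Γ.length_pos e).le]
            exact (Real.sqrt_pos.2 (Γ.length_pos e)).ne'
          simp only [inner_smul_right]
          rw [div_mul_cancel₀ _ hne]
          ring, fun v' hv' => by
            refine Pi.single_eq_of_ne (fun he => hv ?_) _
            rw [← he]; exact hv'⟩
      have h1 := inner_derivative_sub hb' w'
      have h2 := h w'
      rw [robinForm_apply, hsum] at h2
      have ht : ∀ v', Γ.trace v' w' = Pi.single (M := fun _ => ℂ) v 1 v' := fun v' => rfl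
      have h3 : ∀ F : V → ℂ, ∑ v', F v' * Γ.trace v' w' = F v := by
        intro F
        rw [Finset.sum_eq_single v]
        · rw [ht, Pi.single_eq_same, mul_one]
        · intro v' _ hne
          rw [ht, Pi.single_eq_of_ne hne, mul_zero]
        · simp
      rw [h3] at h1 h2
      have h4 : starRingEnd ℂ (Γ.current b g v)
          = starRingEnd ℂ ((if v ∈ R then (σ : ℂ) else 0) * Γ.trace v w) := by
        linear_combination h1 - h2
      exact (starRingEnd ℂ).injective h4
  · rintro ⟨b, hb, hc⟩ w'
    have h1 := inner_derivative_sub hb w'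
    rw [robinForm_apply, hsum]
    simp only [hc] at h1
    linear_combination h1

theorem mem_robinGraph_iff [Fintype V] [DecidableEq V] (R : Finset V) (σ : ℝ) (f g : Γ.L2) :
    (f, g) ∈ Γ.robinGraph R σ ↔ ∃ w : Γ.formDomain, Γ.embedding w = f ∧
      ∀ w', Γ.robinForm R σ w w' = inner ℂ g (Γ.embedding w') := by
  classical
  simp only [robinForm_eq_iff]
  constructor
  · rintro ⟨u, u', c, h⟩
    have hneg : ∀ e, -(g e : ℝ → ℂ) =ᵐ[volume.restrict (Icc 0 (Γ.length e))] (-g e : EdgeL2 _) :=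
      fun e => (Lp.coeFn_neg (g e)).symm
    let h' : ∀ e, EdgeL2 (Γ.length e) := fun e => ofContinuousOn (h.sobolev e).cont'
    have hu : ∀ e, ∀ x ∈ Icc 0 (Γ.length e), u e x = u e 0 + ∫ y in (0 : ℝ)..x, h' e y :=
      fun e x hx => eq_add_primitive_of_hasWeakDeriv (Γ.length_pos e) (h.sobolev e).cont
        ((h.sobolev e).weak.congr (Eventually.of_forall fun _ => rfl)
          (coeFn_ofContinuousOn (h.sobolev e).cont').symm) hx
    have hu' : ∀ e, ∀ x ∈ Icc 0 (Γ.length e),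
        u' e x = u' e 0 + ∫ y in (0 : ℝ)..x, (-g e : EdgeL2 _) y :=
      fun e x hx => eq_add_primitive_of_hasWeakDeriv (Γ.length_pos e) (h.sobolev e).cont'
        ((h.sobolev e).weak'.congr (Eventually.of_forall fun _ => rfl) (hneg e)) hx
    have hend : ∀ e, Γ.length e ∈ Icc 0 (Γ.length e) := fun e => ⟨(Γ.length_pos e).le, le_rfl⟩
    -- `IsRobinPair` may leave the value at an isolated vertex undetermined, whereas the form domain
    -- requires zero there.
    let c' : V → ℂ := fun v => if ∀ e, Γ.src e ≠ v ∧ Γ.tgt e ≠ v then 0 else c v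
    have hc's : ∀ e, c' (Γ.src e) = c (Γ.src e) := fun e => if_neg fun h => (h e).1 rfl
    have hc't : ∀ e, c' (Γ.tgt e) = c (Γ.tgt e) := fun e => if_neg fun h => (h e).2 rfl
    let w : Γ.formDomain := ⟨(c', WithLp.toLp 2 h'), fun e => by
      simp only
      rw [hc's, hc't, ← h.continuity_src, ← h.continuity_tgt, hu e _ (hend e),
        inner_one_eq (Γ.length_pos e).le], fun v hv => if_pos hv⟩
    have hts : ∀ v, Γ.trace v w = c' v := fun v => rfl
    have hd : ∀ e, Γ.derivative w e = h' e := fun e => rfl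
    refine ⟨w, ?_, fun e => u' e 0, fun e => ?_, fun v => ?_⟩
    · ext1 e
      rw [embedding_apply, hts, hc's, hd]
      refine Lp.ext ((coeFn_smul_one_add_volterra _ _).trans ?_)
      filter_upwards [h.repr e, ae_restrict_mem measurableSet_Icc] with x h1 h2
      rw [h1, hu e x h2, h.continuity_src]
    · rw [hd, sub_eq_add_neg, ← map_neg]
      refine Lp.ext (EventuallyEq.trans ?_ (coeFn_smul_one_add_volterra _ _).symm)
      filter_upwards [coeFn_ofContinuousOn (h.sobolev e).cont', ae_restrict_mem measurableSet_Icc]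
        with x h1 h2
      rw [h1, hu' e x h2]
    · have h1 : Γ.current (fun e => u' e 0) g v
          = (∑ e with Γ.src e = v, u' e 0) - ∑ e with Γ.tgt e = v, u' e (Γ.length e) := by
        rw [current]
        congr 1
        refine Finset.sum_congr rfl fun e _ => ?_
        rw [hu' e _ (hend e), ← inner_one_eq (Γ.length_pos e).le, inner_neg_right, sub_eq_add_neg]
      rw [hts]
      by_cases hv : ∀ e, Γ.src e ≠ v ∧ Γ.tgt e ≠ v
      · rw [h1, show c' v = 0 from if_pos hv, mul_zero, Finset.sum_eq_zero, Finset.sum_eq_zero,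
          sub_zero]
        · exact fun e he => absurd (Finset.mem_filter.1 he).2 (hv e).2
        · exact fun e he => absurd (Finset.mem_filter.1 he).2 (hv e).1
      · rw [h1, show c' v = c v from if_neg hv]
        exact h.current v
  · rintro ⟨w, rfl, b, hb, hcur⟩
    have hneg : ∀ e, (-g e : EdgeL2 _) =ᵐ[volume.restrict (Icc 0 (Γ.length e))] -(g e : ℝ → ℂ) :=
      fun e => Lp.coeFn_neg (g e)
    have hend : ∀ e, Γ.length e ∈ Icc 0 (Γ.length e) := fun e => ⟨(Γ.length_pos e).le, le_rfl⟩
    refine ⟨fun e x => Γ.trace (Γ.src e) w + ∫ y in (0 : ℝ)..x, Γ.derivative w e y,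
      fun e x => b e + ∫ y in (0 : ℝ)..x, (-g e : EdgeL2 _) y, fun v => Γ.trace v w,
      fun e => ?_, fun e => ?_, fun e => ?_, fun e => ?_, fun v => ?_⟩
    · simp only [embedding_apply]
      exact coeFn_smul_one_add_volterra _ _
    · refine ⟨continuousOn_add_primitive _ _, continuousOn_add_primitive _ _,
        (Lp.memLp (g e)).neg, ?_, ?_⟩
      · refine (hasWeakDeriv_primitive (Γ.length_pos e).le _ _).congr
          (Eventually.of_forall fun _ => rfl) ?_
        rw [hb e, sub_eq_add_neg, ← map_neg]
        exact coeFn_smul_one_add_volterra _ _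
      · exact (hasWeakDeriv_primitive (Γ.length_pos e).le _ _).congr
          (Eventually.of_forall fun _ => rfl) (hneg e)
    · simp
    · simp only
      rw [trace_tgt, inner_one_eq (Γ.length_pos e).le]
    · rw [← hcur v, current]
      congr 1
      · simp
      · refine Finset.sum_congr rfl fun e _ => ?_
        rw [← inner_one_eq (Γ.length_pos e).le, inner_neg_right, sub_eq_add_neg]

theorem mem_eigenspace_iff_form [Fintype V] [DecidableEq V] (R : Finset V) (σ : ℝ) (μ : ℂ)
    (f : Γ.L2) :
    f ∈ Γ.eigenspace R σ μ ↔ ∃ w : Γ.formDomain, Γ.embedding w = f ∧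
      ∀ w', Γ.robinForm R σ w w' = starRingEnd ℂ μ * inner ℂ f (Γ.embedding w') := by
  rw [eigenspace, robinLaplacian_graph, Submodule.mem_comap]
  change (f, μ • f) ∈ Γ.robinGraph R σ ↔ _
  simp only [mem_robinGraph_iff, inner_smul_left]

end MetricGraph


/-! ### The resolvent and the discreteness of the spectrum -/

/-- The representation theorem for a form that is closed on a compactly embedded domain. -/
theorem exists_form_resolvent {D H K : Type*} [NormedAddCommGroup D] [NormedSpace ℂ D]
    [CompleteSpace D] [NormedAddCommGroup H] [InnerProductSpace ℂ H] [CompleteSpace H]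
    [NormedAddCommGroup K] [InnerProductSpace ℂ K] [CompleteSpace K] (J : D →L[ℂ] H)
    (hJ : IsCompactOperator J) (Φ : D →L[ℂ] K) {c : NNReal} (hΦ : AntilipschitzWith c Φ) :
    ∃ T : H →L[ℂ] H, IsCompactOperator T ∧ ∀ f, ∃ w, T f = J w ∧
      ∀ w', inner ℂ (Φ w) (Φ w') = inner ℂ f (J w') := by
  have hcl : IsClosed (Set.range Φ) := hΦ.isClosed_range Φ.uniformContinuous
  have : CompleteSpace Φ.range := hcl.completeSpace_coe
  let e : D ≃L[ℂ] Φ.range := Φ.equivRange hΦ.injective hcl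
  let J' : Φ.range →L[ℂ] H := J.comp (e.symm : Φ.range →L[ℂ] D)
  have hJ' : IsCompactOperator J' := hJ.comp_clm (e.symm : Φ.range →L[ℂ] D)
  -- With the domain identified with the closed range of `Φ`, the map `f ↦ w` is the adjoint of the
  -- embedding `J'`, so `T = J' J'*`.
  refine ⟨J'.comp J'.adjoint, hJ'.comp_clm J'.adjoint, fun f => ?_⟩
  refine ⟨e.symm (J'.adjoint f), rfl, fun w' => ?_⟩
  have h1 := J'.adjoint_inner_left (e w') f
  have h2 : (J'.adjoint f : K) = Φ (e.symm (J'.adjoint f)) :=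
    congrArg Subtype.val (e.apply_symm_apply (J'.adjoint f)).symm
  have h3 : J' (e w') = J w' := congrArg J (e.symm_apply_apply w')
  rw [h3, Submodule.coe_inner, h2] at h1
  exact h1

namespace MetricGraph

open EdgeL2

variable {V E : Type*} [Fintype E] {Γ : MetricGraph V E}

theorem re_robinForm_nonneg (R : Finset V) {σ : ℝ} (hσ : 0 ≤ σ) (w : Γ.formDomain) :
    0 ≤ (Γ.robinForm R σ w w).re := by
  rw [re_robinForm]
  have := boundaryForm_nonneg R w
  positivity

theorem not_finiteDimensional_L2 [Nonempty E] (Γ : MetricGraph V E) :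
    ¬ FiniteDimensional ℂ Γ.L2 := by
  intro h
  obtain ⟨e⟩ := ‹Nonempty E›
  have hsurj : Function.Surjective
      (PiLp.proj (𝕜 := ℂ) 2 (fun e => EdgeL2 (Γ.length e)) e : Γ.L2 →ₗ[ℂ] EdgeL2 (Γ.length e)) := by
    classical
    intro x
    exact ⟨PiLp.single 2 e x, by simp⟩
  exact EdgeL2.not_finiteDimensional (Γ.length_pos e) (Module.Finite.of_surjective _ hsurj)

variable [Fintype V] [DecidableEq V]

/-- A Hilbert space in which the form domain embeds so that the norm is the form norm. -/
abbrev FormSpace (Γ : MetricGraph V E) : Type _ :=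
  WithLp 2 (Γ.L2 × WithLp 2 (Γ.L2 × EuclideanSpace ℂ V))

/-- The values at the vertices of `R`, multiplied by `√σ`. -/
def scaledTrace (Γ : MetricGraph V E) (R : Finset V) (σ : ℝ) :
    Γ.formDomain →L[ℂ] EuclideanSpace ℂ V :=
  ((PiLp.continuousLinearEquiv 2 ℂ fun _ : V => ℂ).symm : (V → ℂ) →L[ℂ] EuclideanSpace ℂ V).comp
    (ContinuousLinearMap.pi fun v => (if v ∈ R then ((√σ : ℝ) : ℂ) else 0) • Γ.trace v)

/-- The embedding of the form domain that turns the form norm into the Hilbert space norm. -/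
def formEmbedding (Γ : MetricGraph V E) (R : Finset V) (σ : ℝ) : Γ.formDomain →L[ℂ] Γ.FormSpace :=
  ((WithLp.prodContinuousLinearEquiv 2 ℂ Γ.L2 (WithLp 2 (Γ.L2 × EuclideanSpace ℂ V))).symm :
      Γ.L2 × WithLp 2 (Γ.L2 × EuclideanSpace ℂ V) →L[ℂ] Γ.FormSpace).comp
    (Γ.embedding.prod
      (((WithLp.prodContinuousLinearEquiv 2 ℂ Γ.L2 (EuclideanSpace ℂ V)).symm :
        Γ.L2 × EuclideanSpace ℂ V →L[ℂ] WithLp 2 (Γ.L2 × EuclideanSpace ℂ V)).comp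
        (Γ.derivative.prod (Γ.scaledTrace R σ))))

theorem inner_formEmbedding (R : Finset V) {σ : ℝ} (hσ : 0 ≤ σ) (w w' : Γ.formDomain) :
    inner ℂ (Γ.formEmbedding R σ w) (Γ.formEmbedding R σ w')
      = inner ℂ (Γ.embedding w) (Γ.embedding w') + Γ.robinForm R σ w w' := by
  have h1 : inner ℂ (Γ.scaledTrace R σ w) (Γ.scaledTrace R σ w')
      = σ * ∑ v ∈ R, starRingEnd ℂ (Γ.trace v w) * Γ.trace v w' := by
    rw [PiLp.inner_apply, Finset.mul_sum, ← Finset.sum_subset (Finset.subset_univ R)]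
    · refine Finset.sum_congr rfl fun v hv => ?_
      change inner ℂ ((if v ∈ R then ((√σ : ℝ) : ℂ) else 0) • Γ.trace v w)
        ((if v ∈ R then ((√σ : ℝ) : ℂ) else 0) • Γ.trace v w') = _
      rw [if_pos hv, inner_smul_left, inner_smul_right, Complex.conj_ofReal, ← mul_assoc,
        ← Complex.ofReal_mul, Real.mul_self_sqrt hσ, RCLike.inner_apply, mul_comm (Γ.trace v w')]
    · intro v _ hv
      change inner ℂ ((if v ∈ R then ((√σ : ℝ) : ℂ) else 0) • Γ.trace v w) _ = _
      rw [if_neg hv, zero_smul, inner_zero_left]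
  rw [WithLp.prod_inner_apply, robinForm_apply, ← h1]
  congr 1

/-- By the trace inequality the form norm dominates the norm of the form domain, which makes the
form closed. -/
theorem exists_antilipschitz_formEmbedding (Γ : MetricGraph V E) (R : Finset V) (σ : ℝ) :
    ∃ K, AntilipschitzWith K (Γ.formEmbedding R σ) := by
  obtain ⟨K, hK, hle⟩ := Γ.exists_norm_trace_le
  refine ⟨(2 * K + 1).toNNReal, ContinuousLinearMap.antilipschitz_of_bound _ fun w => ?_⟩
  rw [Real.coe_toNNReal _ (by positivity)]
  have h1 : ‖Γ.embedding w‖ ≤ ‖Γ.formEmbedding R σ w‖ :=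
    WithLp.norm_fst_le _ (Γ.formEmbedding R σ w)
  have h2 : ‖Γ.derivative w‖ ≤ ‖Γ.formEmbedding R σ w‖ :=
    (WithLp.norm_fst_le _ (Γ.formEmbedding R σ w).snd).trans
      (WithLp.norm_snd_le _ (Γ.formEmbedding R σ w))
  have hn := norm_nonneg (Γ.formEmbedding R σ w)
  rw [Submodule.coe_norm, Prod.norm_def]
  refine max_le ((pi_norm_le_iff_of_nonneg (by positivity)).2 fun v => ?_) ?_
  · refine (hle v w).trans ?_
    nlinarith [mul_le_mul_of_nonneg_left (add_le_add h1 h2) hK]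
  · refine h2.trans ?_
    nlinarith

theorem exists_resolvent (Γ : MetricGraph V E) (R : Finset V) (σ : ℝ) :
    ∃ T : Γ.L2 →L[ℂ] Γ.L2, IsCompactOperator T ∧ ∀ f, ∃ w : Γ.formDomain, T f = Γ.embedding w ∧
      ∀ w', inner ℂ (Γ.formEmbedding R σ w) (Γ.formEmbedding R σ w')
        = inner ℂ f (Γ.embedding w') := by
  obtain ⟨K, hK⟩ := Γ.exists_antilipschitz_formEmbedding R σ
  exact exists_form_resolvent Γ.embedding Γ.isCompactOperator_embedding (Γ.formEmbedding R σ) hK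

/-- The resolvent `(H^{(σ)} + 1)⁻¹`. -/
def resolvent (Γ : MetricGraph V E) (R : Finset V) (σ : ℝ) : Γ.L2 →L[ℂ] Γ.L2 :=
  (Γ.exists_resolvent R σ).choose

theorem exists_resolvent_eq (R : Finset V) {σ : ℝ} (hσ : 0 ≤ σ) (f : Γ.L2) :
    ∃ w : Γ.formDomain, Γ.resolvent R σ f = Γ.embedding w ∧
      ∀ w', inner ℂ (Γ.embedding w) (Γ.embedding w') + Γ.robinForm R σ w w'
        = inner ℂ f (Γ.embedding w') := by
  obtain ⟨w, h1, h2⟩ := (Γ.exists_resolvent R σ).choose_spec.2 f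
  exact ⟨w, h1, fun w' => by rw [← inner_formEmbedding R hσ, h2]⟩

/-- The range of the embedding is dense: such an `f` makes `w = 0` a weak solution with right side
`f`, so the primitive of `f` is constant on each edge. -/
theorem eq_zero_of_inner_embedding_eq_zero {f : Γ.L2}
    (h : ∀ w, inner ℂ f (Γ.embedding w) = 0) : f = 0 := by
  obtain ⟨b, hb, -⟩ := (robinForm_eq_iff (∅ : Finset V) 0 (0 : Γ.formDomain) f).1
    (fun w' => by rw [h]; simp)
  ext1 e
  have h1 := hb e
  refine (eq_zero_of_smul_one_add_volterra (Γ.length_pos e) (a := -b e) (f := f e) ?_).2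
  rw [map_zero] at h1
  rw [neg_smul, neg_add_eq_sub, ← neg_sub, ← h1]
  simp

/-- Testing the equation of `w` with `w` itself gives `⟨T f, f⟩ = ‖w‖² + q(w)`, where `q` is the
nonnegative quadratic form. Positivity follows by density; with `⟨T f, f⟩ ≤ ‖w‖ ‖f‖` it also gives
`‖w‖ ≤ ‖f‖`, hence `le`. -/
theorem isCompactResolvent (Γ : MetricGraph V E) (R : Finset V) {σ : ℝ} (hσ : 0 ≤ σ) :
    IsCompactResolvent (Γ.resolvent R σ) where
  compact := (Γ.exists_resolvent R σ).choose_spec.1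
  symm := by
    intro f g
    obtain ⟨w, hw, hw'⟩ := exists_resolvent_eq R hσ f
    obtain ⟨z, hz, hz'⟩ := exists_resolvent_eq R hσ g
    change inner ℂ (Γ.resolvent R σ f) g = inner ℂ f (Γ.resolvent R σ g)
    rw [hw, hz, ← hw', ← inner_conj_symm, ← hz', map_add, inner_conj_symm, ← robinForm_conj]
  pos := by
    intro f hf
    obtain ⟨w, hw, hw'⟩ := exists_resolvent_eq R hσ f
    have h1 : (inner ℂ (Γ.resolvent R σ f) f).re
        = ‖Γ.embedding w‖ ^ 2 + (Γ.robinForm R σ w w).re := by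
      rw [hw, ← inner_conj_symm, Complex.conj_re, ← hw', Complex.add_re]
      congr 1
      exact inner_self_eq_norm_sq (𝕜 := ℂ) _
    rw [h1]
    refine add_pos_of_pos_of_nonneg ?_ (re_robinForm_nonneg R hσ w)
    have hne : Γ.embedding w ≠ 0 := by
      intro h0
      refine hf (eq_zero_of_inner_embedding_eq_zero fun w' => ?_)
      rw [← hw', eq_zero_of_embedding_eq_zero h0]
      simp
    positivity
  le := by
    intro f
    obtain ⟨w, hw, hw'⟩ := exists_resolvent_eq R hσ f
    have h1 : (inner ℂ (Γ.resolvent R σ f) f).re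
        = ‖Γ.embedding w‖ ^ 2 + (Γ.robinForm R σ w w).re := by
      rw [hw, ← inner_conj_symm, Complex.conj_re, ← hw', Complex.add_re]
      congr 1
      exact inner_self_eq_norm_sq (𝕜 := ℂ) _
    have h2 : (inner ℂ (Γ.resolvent R σ f) f).re ≤ ‖Γ.embedding w‖ * ‖f‖ := by
      rw [hw]
      exact re_inner_le_norm (𝕜 := ℂ) _ _
    nlinarith [re_robinForm_nonneg R hσ w, sq_nonneg (‖f‖ - ‖Γ.embedding w‖)]

theorem eigenspace_eq_family (R : Finset V) {σ : ℝ} (hσ : 0 ≤ σ) :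
    Γ.eigenspace R σ = IsCompactResolvent.family (Γ.resolvent R σ) := by
  funext μ
  ext f
  rw [mem_eigenspace_iff_form, IsCompactResolvent.mem_family]
  obtain ⟨z, hz, hz'⟩ := exists_resolvent_eq R hσ f
  constructor
  · rintro ⟨w, rfl, hw⟩
    -- At `μ = -1` the family is the kernel of the resolvent, because `0⁻¹ = 0`; both spaces are
    -- trivial there.
    by_cases hμ : 1 + μ = 0
    · have h1 := hw w
      have h2 : μ = -1 := by linear_combination hμ
      have h3 := congrArg Complex.re h1
      have h4 := re_robinForm_nonneg R hσ w
      have h5 : (inner ℂ (Γ.embedding w) (Γ.embedding w)).re = ‖Γ.embedding w‖ ^ 2 :=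
        inner_self_eq_norm_sq (𝕜 := ℂ) _
      rw [h2, map_neg, map_one, neg_one_mul, Complex.neg_re, h5] at h3
      have h6 : ‖Γ.embedding w‖ = 0 := by
        have : ‖Γ.embedding w‖ ^ 2 = 0 := le_antisymm (by linarith) (by positivity)
        exact pow_eq_zero_iff (two_ne_zero) |>.1 this
      rw [norm_eq_zero] at h6
      rw [h6]
      simp
    · have hdiff : ∀ w', inner ℂ (Γ.embedding ((1 + μ) • z - w)) (Γ.embedding w')
          + Γ.robinForm R σ ((1 + μ) • z - w) w' = 0 := by
        intro w'
        have h1 := hz' w'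
        have h2 := hw w'
        simp only [map_sub, map_smul, LinearMap.map_smulₛₗ, LinearMap.sub_apply,
          LinearMap.smul_apply, inner_sub_left, inner_smul_left, smul_eq_mul, map_add, map_one]
        linear_combination (1 + starRingEnd ℂ μ) * h1 - h2
      have h0 : Γ.embedding ((1 + μ) • z - w) = 0 := by
        have h1 := congrArg Complex.re (hdiff ((1 + μ) • z - w))
        have h4 := re_robinForm_nonneg R hσ ((1 + μ) • z - w)
        have h5 : (inner ℂ (Γ.embedding ((1 + μ) • z - w)) (Γ.embedding ((1 + μ) • z - w))).re
          = ‖Γ.embedding ((1 + μ) • z - w)‖ ^ 2 := inner_self_eq_norm_sq (𝕜 := ℂ) _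
        rw [Complex.add_re, h5, Complex.zero_re] at h1
        have : ‖Γ.embedding ((1 + μ) • z - w)‖ ^ 2 = 0 := le_antisymm (by linarith) (by positivity)
        exact norm_eq_zero.1 (pow_eq_zero_iff (two_ne_zero) |>.1 this)
      rw [map_sub, map_smul, sub_eq_zero] at h0
      rw [hz, ← h0, smul_smul, inv_mul_cancel₀ hμ, one_smul]
  · intro hf
    rw [hz] at hf
    by_cases hμ : 1 + μ = 0
    · rw [hμ, inv_zero, zero_smul] at hf
      have hz0 := eq_zero_of_embedding_eq_zero hf
      have hf0 : f = 0 := eq_zero_of_inner_embedding_eq_zero fun w' => by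
        rw [← hz', hz0]; simp
      exact ⟨0, by rw [hf0, map_zero], fun w' => by rw [hf0]; simp⟩
    · have h1 : f = (1 + μ) • Γ.embedding z := by
        rw [hf, smul_smul, mul_inv_cancel₀ hμ, one_smul]
      refine ⟨(1 + μ) • z, by rw [map_smul, ← h1], fun w' => ?_⟩
      have h2 := hz' w'
      rw [h1, inner_smul_left] at h2 ⊢
      rw [LinearMap.map_smulₛₗ, LinearMap.smul_apply, smul_eq_mul]
      simp only [map_add, map_one] at h2 ⊢
      linear_combination (1 + starRingEnd ℂ μ) * h2

theorem discreteSpectrum [Nonempty E] (Γ : MetricGraph V E) (R : Finset V) {σ : ℝ} (hσ : 0 ≤ σ) :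
    DiscreteSpectrum (Γ.eigenspace R σ) := by
  rw [eigenspace_eq_family R hσ]
  exact (Γ.isCompactResolvent R hσ).discreteSpectrum Γ.not_finiteDimensional_L2

theorem isEigenvalueSequence [Nonempty E] (Γ : MetricGraph V E) (R : Finset V) {σ : ℝ}
    (hσ : 0 ≤ σ) : Γ.IsEigenvalueSequence R σ (Γ.eigenvalue R σ) where
  monotone := (Γ.discreteSpectrum R hσ).orderedEigenvalue_monotone
  tendsto := (Γ.discreteSpectrum R hσ).tendsto_orderedEigenvalue
  finite := (Γ.discreteSpectrum R hσ).finiteDimensional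
  multiplicity := (Γ.discreteSpectrum R hσ).finrank_eq_ncard

end MetricGraph


/-! ### Boundary values of eigenfunctions on an edge -/

namespace EdgeL2

variable {ℓ : ℝ}

theorem norm_sq_eq (f : EdgeL2 ℓ) : ‖f‖ ^ 2 = ∫ x in Icc 0 ℓ, ‖f x‖ ^ 2 := by
  have h1 : inner ℂ f f = ((∫ x in Icc 0 ℓ, ‖f x‖ ^ 2 : ℝ) : ℂ) := by
    rw [inner_eq, ← integral_complex_ofReal]
    refine integral_congr_ae (Eventually.of_forall fun x => ?_)
    simp only
    rw [← Complex.normSq_eq_conj_mul_self, Complex.normSq_eq_norm_sq]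
  have h2 := congrArg Complex.re h1
  rw [Complex.ofReal_re] at h2
  exact (inner_self_eq_norm_sq (𝕜 := ℂ) f).symm.trans h2

/-- A weak solution of `-u'' = μ u` has a smooth representative. -/
theorem exists_classical_solution (hℓ : 0 ≤ ℓ) {f k : EdgeL2 ℓ} {a b μ : ℂ}
    (hf : f = a • one ℓ + volterra ℓ k) (hk : k = b • one ℓ - volterra ℓ (μ • f)) :
    ∃ u p : ℝ → ℂ, f =ᵐ[volume.restrict (Icc 0 ℓ)] u ∧ u 0 = a ∧
      u ℓ = a + inner ℂ (one ℓ) k ∧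
      ∀ x ∈ Icc 0 ℓ, HasDerivAt u (p x) x ∧ HasDerivAt p (-μ * u x) x := by
  have hfu : f =ᵐ[volume.restrict (Icc 0 ℓ)] fun x => a + ∫ y in (0 : ℝ)..x, k y := by
    conv_lhs => rw [hf]
    exact coeFn_smul_one_add_volterra a k
  -- The continuous representative is extended by constants beyond the edge, so that its primitives
  -- have two-sided derivatives at the end points too.
  have hcont : Continuous fun x => a + ∫ y in (0 : ℝ)..(projIcc 0 ℓ hℓ x), k y :=
    (continuousOn_iff_continuous_domRestrict.1 (continuousOn_add_primitive a k)).comp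
      continuous_projIcc
  have hfu' : f =ᵐ[volume.restrict (Icc 0 ℓ)]
      fun x => a + ∫ y in (0 : ℝ)..(projIcc 0 ℓ hℓ x), k y := by
    filter_upwards [hfu, ae_restrict_mem measurableSet_Icc] with x h1 h2
    rw [h1, projIcc_of_mem hℓ h2]
  set q : ℝ → ℂ := fun x => a + ∫ y in (0 : ℝ)..(projIcc 0 ℓ hℓ x), k y with hq
  have hp : ∀ x, HasDerivAt (fun x => b + ∫ y in (0 : ℝ)..x, -μ * q y) (-μ * q x) x := fun x =>
    (intervalIntegral.integral_hasDerivAt_right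
      ((continuous_const.mul hcont).intervalIntegrable _ _)
      (continuous_const.mul hcont).aestronglyMeasurable.stronglyMeasurableAtFilter
      (continuous_const.mul hcont).continuousAt).const_add b
  have hpc : Continuous (fun x => b + ∫ y in (0 : ℝ)..x, -μ * q y) :=
    continuous_iff_continuousAt.2 fun x => (hp x).continuousAt
  have hkp : k =ᵐ[volume.restrict (Icc 0 ℓ)] fun x => b + ∫ y in (0 : ℝ)..x, -μ * q y := by
    have h1 : k = b • one ℓ + volterra ℓ (-(μ • f)) := by rw [map_neg, ← sub_eq_add_neg, ← hk]
    conv_lhs => rw [h1]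
    refine (coeFn_smul_one_add_volterra b _).trans ?_
    filter_upwards [ae_restrict_mem measurableSet_Icc] with x hx
    congr 1
    refine primitive_congr ?_ hx
    filter_upwards [Lp.coeFn_neg (μ • f), Lp.coeFn_smul μ f, hfu'] with y h1 h2 h3
    rw [h1, Pi.neg_apply, h2, Pi.smul_apply, h3, smul_eq_mul, neg_mul]
  set p : ℝ → ℂ := fun x => b + ∫ y in (0 : ℝ)..x, -μ * q y with hpdef
  have hu : ∀ x, HasDerivAt (fun x => a + ∫ y in (0 : ℝ)..x, p y) (p x) x := fun x =>
    (intervalIntegral.integral_hasDerivAt_right (hpc.intervalIntegrable _ _)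
      hpc.aestronglyMeasurable.stronglyMeasurableAtFilter hpc.continuousAt).const_add a
  have huq : ∀ x ∈ Icc 0 ℓ, a + ∫ y in (0 : ℝ)..x, p y = q x := by
    intro x hx
    simp only [hq, projIcc_of_mem hℓ hx]
    rw [primitive_congr hkp hx]
  refine ⟨fun x => a + ∫ y in (0 : ℝ)..x, p y, p, ?_, by simp, ?_, fun x hx => ⟨hu x, ?_⟩⟩
  · filter_upwards [hfu', ae_restrict_mem measurableSet_Icc] with x h1 h2
    rw [huq x h2, h1]
  · rw [inner_one_eq hℓ, primitive_congr hkp ⟨hℓ, le_rfl⟩]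
  · simp only
    rw [huq x hx]
    exact hp x

/-- The boundary values of an eigenfunction for a large eigenvalue are controlled by its norm. -/
theorem norm_sq_boundary_le (hℓ : 0 < ℓ) {f k : EdgeL2 ℓ} {a b : ℂ} {μ : ℝ}
    (hμ : 2 / ℓ ≤ √μ) (hf : f = a • one ℓ + volterra ℓ k)
    (hk : k = b • one ℓ - volterra ℓ ((μ : ℂ) • f)) :
    ‖a‖ ^ 2 ≤ 4 / ℓ * ‖f‖ ^ 2 ∧ ‖a + inner ℂ (one ℓ) k‖ ^ 2 ≤ 4 / ℓ * ‖f‖ ^ 2 := by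
  obtain ⟨u, p, hfu, hu0, huℓ, hder⟩ := exists_classical_solution hℓ.le hf hk
  have hs : 0 < √μ := lt_of_lt_of_le (by positivity) hμ
  have hμ0 : 0 < μ := Real.sqrt_pos.1 hs
  have hμs : √μ ^ 2 = μ := Real.sq_sqrt hμ0.le
  have hder2 : ∀ x ∈ Icc 0 ℓ, HasDerivAt p (-(μ • u x)) x := fun x hx => by
    have h := (hder x hx).2
    rwa [neg_mul, ← Complex.real_smul] at h
  -- Conservation of energy for the oscillator `u'' = -μ u`.
  have hA : ∀ x ∈ Icc 0 ℓ, ‖p x‖ ^ 2 + μ * ‖u x‖ ^ 2 = ‖p 0‖ ^ 2 + μ * ‖u 0‖ ^ 2 := by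
    have hd : ∀ x ∈ Icc 0 ℓ, HasDerivAt (fun x => ‖p x‖ ^ 2 + μ * ‖u x‖ ^ 2) 0 x := by
      intro x hx
      have h := (hder2 x hx).norm_sq.add (((hder x hx).1.norm_sq).const_mul μ)
      refine h.congr_deriv ?_
      rw [inner_neg_right, real_inner_smul_right, real_inner_comm]
      ring
    intro x hx
    exact constant_of_has_deriv_right_zero (fun y hy => (hd y hy).continuousAt.continuousWithinAt)
      (fun y hy => (hd y (Ico_subset_Icc_self hy)).hasDerivWithinAt) x hx
  set A := ‖p 0‖ ^ 2 + μ * ‖u 0‖ ^ 2 with hAdef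
  have hA0 : 0 ≤ A := by positivity
  have hG : ∀ x ∈ Icc 0 ℓ, HasDerivAt (fun x => inner ℝ (u x) (p x))
      (A - 2 * μ * ‖u x‖ ^ 2) x := by
    intro x hx
    have h := (hder x hx).1.inner ℝ (hder2 x hx)
    refine h.congr_deriv ?_
    rw [inner_neg_right, real_inner_smul_right, real_inner_self_eq_norm_sq,
      real_inner_self_eq_norm_sq, ← hA x hx]
    ring
  -- Since `2√μ |u||p| ≤ A`, the hypothesis `2 ≤ √μ ℓ` is what makes each boundary term at most a
  -- quarter of `Aℓ`.
  have hGb : ∀ x ∈ Icc 0 ℓ, |inner ℝ (u x) (p x)| ≤ A * ℓ / 4 := by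
    intro x hx
    have h1 := abs_real_inner_le_norm (u x) (p x)
    have h2 : 2 * (√μ * (‖u x‖ * ‖p x‖)) ≤ A := by
      rw [← hA x hx]
      nlinarith [sq_nonneg (√μ * ‖u x‖ - ‖p x‖)]
    have h3 : 2 ≤ √μ * ℓ := by rwa [div_le_iff₀ hℓ] at hμ
    have h4 : 0 ≤ ‖u x‖ * ‖p x‖ := by positivity
    nlinarith [mul_le_mul_of_nonneg_right h2 hℓ.le, mul_le_mul_of_nonneg_right h3 h4]
  have hucont : ContinuousOn u (Icc 0 ℓ) := fun x hx =>
    (hder x hx).1.continuousAt.continuousWithinAt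
  have hint : IntervalIntegrable (fun x => ‖u x‖ ^ 2) volume 0 ℓ := by
    refine ContinuousOn.intervalIntegrable ?_
    rw [uIcc_of_le hℓ.le]
    exact hucont.norm.pow 2
  have hnorm : ‖f‖ ^ 2 = ∫ x in (0 : ℝ)..ℓ, ‖u x‖ ^ 2 := by
    rw [norm_sq_eq, intervalIntegral.integral_of_le hℓ.le, ← integral_Icc_eq_integral_Ioc]
    exact integral_congr_ae (hfu.mono fun x hx => by simp only [hx])
  have hFTC := intervalIntegral.integral_eq_sub_of_hasDerivAt (a := 0) (b := ℓ)
    (f := fun x => inner ℝ (u x) (p x)) (f' := fun x => A - 2 * μ * ‖u x‖ ^ 2)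
    (fun x hx => hG x (by rwa [uIcc_of_le hℓ.le] at hx))
    (intervalIntegrable_const.sub (hint.const_mul _))
  rw [intervalIntegral.integral_sub intervalIntegrable_const (hint.const_mul _),
    intervalIntegral.integral_const, intervalIntegral.integral_const_mul, ← hnorm, sub_zero,
    smul_eq_mul] at hFTC
  have hb0 := abs_le.1 (hGb 0 (left_mem_Icc.2 hℓ.le))
  have hb1 := abs_le.1 (hGb ℓ (right_mem_Icc.2 hℓ.le))
  -- The two boundary terms take up at most half of `Aℓ`; the other half is bounded by `2μ‖f‖²`.
  have hmain : A * ℓ ≤ 4 * μ * ‖f‖ ^ 2 := by linarith [hb0.1, hb1.2]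
  have hfin : ∀ x ∈ Icc 0 ℓ, ‖u x‖ ^ 2 ≤ 4 / ℓ * ‖f‖ ^ 2 := by
    intro x hx
    have h1 : μ * ‖u x‖ ^ 2 ≤ A := by
      rw [← hA x hx]
      linarith [sq_nonneg ‖p x‖]
    have h2 : μ * (‖u x‖ ^ 2 * ℓ) ≤ μ * (4 * ‖f‖ ^ 2) := by
      nlinarith [mul_le_mul_of_nonneg_right h1 hℓ.le]
    have h3 := le_of_mul_le_mul_left h2 hμ0
    rw [div_mul_eq_mul_div, le_div_iff₀ hℓ]
    exact h3
  refine ⟨?_, ?_⟩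
  · rw [← hu0]; exact hfin 0 (left_mem_Icc.2 hℓ.le)
  · rw [← huℓ]; exact hfin ℓ (right_mem_Icc.2 hℓ.le)

end EdgeL2


/-! ### Variational comparison and the Lipschitz bound -/

/-- A subspace meets the orthogonal complement of each subspace of smaller dimension. -/
theorem exists_ne_zero_map_mem_orthogonal {D H : Type*} [AddCommGroup D] [Module ℂ D]
    [NormedAddCommGroup H] [InnerProductSpace ℂ H] (J : D →ₗ[ℂ] H) (S : Submodule ℂ D)
    (X : Submodule ℂ H) [FiniteDimensional ℂ S] [FiniteDimensional ℂ X]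
    (h : Module.finrank ℂ X < Module.finrank ℂ S) : ∃ w ∈ S, w ≠ 0 ∧ J w ∈ Xᗮ := by
  let P : S →ₗ[ℂ] X := (X.orthogonalProjectionOnto : H →ₗ[ℂ] X) ∘ₗ J ∘ₗ S.subtype
  obtain ⟨w, hwP, hw0⟩ := Submodule.exists_mem_ne_zero_of_ne_bot
    (LinearMap.ker_ne_bot_of_finrank_lt (f := P) h)
  exact ⟨w, w.2, fun h0 => hw0 (Subtype.ext h0),
    Submodule.orthogonalProjectionOnto_eq_zero_iff.1 (LinearMap.mem_ker.1 hwP)⟩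

/-- Cauchy–Schwarz gives `N² ≤ r (N + q)`. With `y` the form embedding of a trial function and `x`
that of its resolvent, an upper bound on the resolvent form becomes a lower bound on the quadratic
form `q`. -/
theorem mul_lt_of_re_inner_lt {K : Type*} [NormedAddCommGroup K] [InnerProductSpace ℂ K] {x y : K}
    {N r q t : ℝ} (hN : 0 < N) (ht : 0 ≤ t) (hxy : (inner ℂ x y).re = N)
    (hxx : (inner ℂ x x).re = r) (hyy : (inner ℂ y y).re = N + q) (hr : r < (1 + t)⁻¹ * N) :
    t * N < q := by
  have hx : ‖x‖ ^ 2 = r := (inner_self_eq_norm_sq (𝕜 := ℂ) x).symm.trans hxx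
  have hy : ‖y‖ ^ 2 = N + q := (inner_self_eq_norm_sq (𝕜 := ℂ) y).symm.trans hyy
  have hle : N ≤ ‖x‖ * ‖y‖ := hxy ▸ re_inner_le_norm (𝕜 := ℂ) x y
  have h1 : N ^ 2 ≤ r * (N + q) := by
    rw [← hx, ← hy, ← mul_pow]
    gcongr
  have hy0 : 0 < N + q := by
    rw [← hy]
    refine lt_of_le_of_ne (sq_nonneg _) fun h => ?_
    rw [← hy, ← h, mul_zero] at h1
    nlinarith
  have h2 : N * N < (1 + t)⁻¹ * N * (N + q) := by
    rw [← sq]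
    exact h1.trans_lt (mul_lt_mul_of_pos_right hr hy0)
  rw [mul_assoc, lt_inv_mul_iff₀ (by positivity), ← mul_assoc, mul_comm N (N + q)] at h2
  have h3 := lt_of_mul_lt_mul_right h2 hN.le
  linarith

/-- The slack `ε * a` in the lower part pays for its boundary term `2 * h * B₁`; only the boundary
term of the eigenspace part raises the bound. -/
theorem perturbed_form_le {t ε h K C a b B B₁ B₂ q₁ q₂ : ℝ} (h0 : 0 ≤ h) (hC : 0 ≤ C)
    (ha : 0 ≤ a) (hh : 2 * h * (K * (1 + t)) ≤ ε) (hB : B ≤ 2 * B₁ + 2 * B₂)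
    (hB₁ : B₁ ≤ K * (1 + t) * a) (hB₂ : B₂ ≤ C * b) (hq₁ : q₁ ≤ (t - ε) * a) (hq₂ : q₂ = t * b) :
    q₁ + q₂ + h * B ≤ (t + 2 * C * h) * (a + b) := by
  have hb1 := mul_le_mul_of_nonneg_left hB h0
  have hb2 := mul_le_mul_of_nonneg_left hB₁ (by positivity : 0 ≤ 2 * h)
  have hb3 := mul_le_mul_of_nonneg_left hB₂ (by positivity : 0 ≤ 2 * h)
  have hb4 := mul_le_mul_of_nonneg_right hh ha
  have hb5 : 0 ≤ 2 * C * h * a := by positivity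
  linarith

namespace MetricGraph

open EdgeL2

variable {V E : Type*} [Fintype E] {Γ : MetricGraph V E}

/-- The functions `w` of the form domain that satisfy `H^{(σ)} w = μ w` in the weak sense. -/
def eigenLift (Γ : MetricGraph V E) (R : Finset V) (σ : ℝ) (μ : ℂ) : Submodule ℂ Γ.formDomain where
  carrier := {w | ∀ w', Γ.robinForm R σ w w'
    = starRingEnd ℂ μ * inner ℂ (Γ.embedding w) (Γ.embedding w')}
  zero_mem' := by simp
  add_mem' := by
    intro w z hw hz w'
    rw [map_add, LinearMap.add_apply, hw, hz, map_add, inner_add_left, mul_add]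
  smul_mem' := by
    intro a w hw w'
    rw [LinearMap.map_smulₛₗ, LinearMap.smul_apply, hw, map_smul, inner_smul_left, smul_eq_mul]
    ring

theorem re_robinForm_le (R : Finset V) (σ : ℝ) {t : ℝ} {w : Γ.formDomain}
    (hw : w ∈ spectralSpace (Γ.eigenLift R σ) t) :
    (Γ.robinForm R σ w w).re ≤ t * ‖Γ.embedding w‖ ^ 2 :=
  form_le_of_mem_iSup (Γ.robinForm R σ) (Γ.embedding : Γ.formDomain →ₗ[ℂ] Γ.L2)
    (robinForm_conj R σ) (fun μ : Iic t => Γ.eigenLift R σ ((μ : ℝ) : ℂ)) (fun μ => (μ : ℝ))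
    Subtype.val_injective (fun μ w hw w' => by
      have h := hw w'
      rwa [Complex.conj_ofReal] at h) (fun μ => μ.2) hw

theorem inner_eq_zero_of_mem (R : Finset V) (σ : ℝ) {s t : ℝ} (hst : s < t) {w z : Γ.formDomain}
    (hw : w ∈ spectralSpace (Γ.eigenLift R σ) s) (hz : z ∈ Γ.eigenLift R σ t) :
    inner ℂ (Γ.embedding z) (Γ.embedding w) = 0 := by
  refine Submodule.iSup_induction _
    (motive := fun w => inner ℂ (Γ.embedding z) (Γ.embedding w) = 0) hw (fun μ y hy => ?_)
    (by simp) (fun y y' h h' => by rw [map_add, inner_add_right, h, h', add_zero])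
  have h1 := hy z
  have h2 := hz y
  rw [robinForm_conj, h1, map_mul, Complex.conj_conj, inner_conj_symm, Complex.conj_ofReal] at h2
  have h3 : (((t - (μ : ℝ) : ℝ)) : ℂ) * inner ℂ (Γ.embedding z) (Γ.embedding y) = 0 := by
    push_cast
    rw [sub_mul, h2, sub_self]
  rcases mul_eq_zero.1 h3 with h | h
  · have h4 : t - (μ : ℝ) = 0 := Complex.ofReal_eq_zero.1 h
    have h5 : (μ : ℝ) ≤ s := μ.2
    linarith
  · exact h

theorem norm_derivative_sq_le (R : Finset V) {σ t : ℝ} (hσ : 0 ≤ σ) {w : Γ.formDomain}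
    (hw : (Γ.robinForm R σ w w).re ≤ t * ‖Γ.embedding w‖ ^ 2) :
    ‖Γ.derivative w‖ ^ 2 ≤ t * ‖Γ.embedding w‖ ^ 2 := by
  rw [re_robinForm] at hw
  have := mul_nonneg hσ (boundaryForm_nonneg R w)
  linarith

theorem re_robinForm_of_mem (R : Finset V) {σ μ : ℝ} {w : Γ.formDomain}
    (hw : w ∈ Γ.eigenLift R σ μ) :
    (Γ.robinForm R σ w w).re = μ * ‖Γ.embedding w‖ ^ 2 := by
  rw [hw w, Complex.conj_ofReal, Complex.re_ofReal_mul]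
  exact congrArg (μ * ·) (inner_self_eq_norm_sq (𝕜 := ℂ) _)

theorem boundaryForm_add_le (R : Finset V) (w z : Γ.formDomain) :
    Γ.boundaryForm R (w + z) ≤ 2 * Γ.boundaryForm R w + 2 * Γ.boundaryForm R z := by
  simp only [boundaryForm, Finset.mul_sum, ← Finset.sum_add_distrib]
  refine Finset.sum_le_sum fun v _ => ?_
  rw [map_add]
  have h1 := norm_add_le (Γ.trace v w) (Γ.trace v z)
  nlinarith [norm_nonneg (Γ.trace v w + Γ.trace v z), sq_nonneg (‖Γ.trace v w‖ - ‖Γ.trace v z‖)]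

theorem injective_embedding [Fintype V] (Γ : MetricGraph V E) :
    Function.Injective (Γ.embedding : Γ.formDomain →ₗ[ℂ] Γ.L2) :=
  (injective_iff_map_eq_zero _).2 fun _ h => eq_zero_of_embedding_eq_zero h

variable [Fintype V] [DecidableEq V]

theorem map_eigenLift (R : Finset V) (σ : ℝ) (μ : ℂ) :
    (Γ.eigenLift R σ μ).map (Γ.embedding : Γ.formDomain →ₗ[ℂ] Γ.L2) = Γ.eigenspace R σ μ := by
  ext f
  rw [mem_eigenspace_iff_form, Submodule.mem_map]
  constructor
  · rintro ⟨w, hw, rfl⟩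
    exact ⟨w, rfl, hw⟩
  · rintro ⟨w, rfl, hw⟩
    exact ⟨w, hw, rfl⟩

theorem map_spectralSpace_eigenLift (R : Finset V) (σ t : ℝ) :
    (spectralSpace (Γ.eigenLift R σ) t).map (Γ.embedding : Γ.formDomain →ₗ[ℂ] Γ.L2)
      = spectralSpace (Γ.eigenspace R σ) t := by
  simp only [spectralSpace, Submodule.map_iSup, map_eigenLift]

/-- The identification of the weak and the strong eigenfunctions for eigenvalues up to `t`. -/
def spectralSpaceEquiv (Γ : MetricGraph V E) (R : Finset V) (σ t : ℝ) :
    spectralSpace (Γ.eigenLift R σ) t ≃ₗ[ℂ] spectralSpace (Γ.eigenspace R σ) t :=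
  (Submodule.equivMapOfInjective _ Γ.injective_embedding _).trans
    (LinearEquiv.ofEq _ _ (map_spectralSpace_eigenLift R σ t))

/-- Eigenfunctions have uniformly bounded boundary values. -/
theorem exists_boundaryForm_le_of_mem_eigenLift (Γ : MetricGraph V E) (R : Finset V) :
    ∃ C : ℝ, 0 ≤ C ∧ ∀ σ μ : ℝ, 0 ≤ σ → 0 ≤ μ → ∀ w ∈ Γ.eigenLift R σ μ,
      Γ.boundaryForm R w ≤ C * ‖Γ.embedding w‖ ^ 2 := by
  obtain ⟨K, hK, hle⟩ := Γ.exists_boundaryForm_le R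
  have hpos : ∀ e, 0 < Γ.length e := Γ.length_pos
  set m := ∑ e, 2 / Γ.length e with hm
  set L := ∑ e, 4 / Γ.length e with hL
  have hm0 : 0 ≤ m := Finset.sum_nonneg fun e _ => by have := hpos e; positivity
  have hL0 : 0 ≤ L := Finset.sum_nonneg fun e _ => by have := hpos e; positivity
  refine ⟨R.card * L + K * (1 + m ^ 2), by positivity, fun σ μ hσ hμ w hw => ?_⟩
  rw [add_mul]
  -- If `μ ≥ m²`, then `√μ ≥ 2 / ℓ` on every edge and the energy estimate applies; otherwise `‖w'‖²
  -- ≤ μ‖w‖² ≤ m²‖w‖²` and the trace inequality suffices.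
  rcases le_or_gt (m ^ 2) μ with hmu | hmu
  · refine le_trans ?_ (le_add_of_nonneg_right (by positivity))
    have hsq : m ≤ √μ := Real.le_sqrt_of_sq_le hmu
    obtain ⟨b, hb, -⟩ := (robinForm_eq_iff R σ w ((μ : ℂ) • Γ.embedding w)).1
      (fun w' => by rw [hw w', inner_smul_left])
    have hbd := fun e => norm_sq_boundary_le (hpos e) (f := Γ.embedding w e)
      (k := Γ.derivative w e) (a := Γ.trace (Γ.src e) w) (b := b e) (μ := μ)
      ((Finset.single_le_sum (f := fun e => 2 / Γ.length e)
        (fun e _ => by have := hpos e; positivity) (Finset.mem_univ e)).trans hsq)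
      (embedding_apply w e) (hb e)
    have hLe : ∀ e, 4 / Γ.length e * ‖Γ.embedding w e‖ ^ 2 ≤ L * ‖Γ.embedding w‖ ^ 2 := by
      intro e
      have h1 : 4 / Γ.length e ≤ L := Finset.single_le_sum (f := fun e => 4 / Γ.length e)
        (fun e _ => by have := hpos e; positivity) (Finset.mem_univ e)
      have h2 : ‖Γ.embedding w e‖ ≤ ‖Γ.embedding w‖ := PiLp.norm_apply_le _ e
      gcongr
    rw [boundaryForm, mul_assoc, ← nsmul_eq_mul]
    refine Finset.sum_le_card_nsmul _ _ _ fun v _ => ?_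
    by_cases hv : ∀ e, Γ.src e ≠ v ∧ Γ.tgt e ≠ v
    · rw [trace_eq_zero w hv]
      simp only [norm_zero, ne_eq, OfNat.ofNat_ne_zero, not_false_eq_true, zero_pow]
      positivity
    · push Not at hv
      obtain ⟨e, he⟩ := hv
      by_cases hs : Γ.src e = v
      · rw [← hs]; exact (hbd e).1.trans (hLe e)
      · rw [← he hs, trace_tgt]; exact (hbd e).2.trans (hLe e)
  · refine le_trans ?_ (le_add_of_nonneg_left (by positivity))
    have h1 := norm_derivative_sq_le R hσ (re_robinForm_of_mem R hw).le
    refine (hle w).trans ?_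
    rw [mul_assoc]
    gcongr
    nlinarith [sq_nonneg ‖Γ.embedding w‖]

variable [Nonempty E]

/-- The variational upper bound for the eigenvalues. -/
theorem eigenvalue_le_of_form_le (R : Finset V) {σ : ℝ} (hσ : 0 ≤ σ) {n : ℕ} {t : ℝ}
    (S : Submodule ℂ Γ.formDomain) [FiniteDimensional ℂ S] (hn : n < Module.finrank ℂ S)
    (hS : ∀ w ∈ S, (Γ.robinForm R σ w w).re ≤ t * ‖Γ.embedding w‖ ^ 2) :
    Γ.eigenvalue R σ n ≤ t := by
  have hD := Γ.discreteSpectrum R hσ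
  have hfin := hD.finite t
  refine (hD.orderedEigenvalue_le_iff n t).2 ?_
  -- If the spectral space had dimension at most `n`, some nonzero trial function would be
  -- orthogonal to it, and the resolvent bound there forces its form strictly above `t‖w‖²`.
  by_contra hcon
  obtain ⟨w, hwS, hw0, hperp⟩ := exists_ne_zero_map_mem_orthogonal
    (Γ.embedding : Γ.formDomain →ₗ[ℂ] Γ.L2) S (spectralSpace (Γ.eigenspace R σ) t)
    (lt_of_le_of_lt (not_lt.1 hcon) hn)
  have hf0 : Γ.embedding w ≠ 0 := fun h => hw0 (eq_zero_of_embedding_eq_zero h)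
  have hq := hS w hwS
  have hq0 := re_robinForm_nonneg R hσ w
  have hnpos : 0 < ‖Γ.embedding w‖ ^ 2 := by positivity
  have ht : 0 ≤ t := by
    by_contra h
    nlinarith [not_le.1 h]
  have hlt := (Γ.isCompactResolvent R hσ).re_inner_lt ht
    (x := Γ.embedding w) (by rw [← eigenspace_eq_family R hσ]; exact hperp) hf0
  obtain ⟨z, hz, hz'⟩ := exists_resolvent_eq R hσ (Γ.embedding w)
  have hww : (inner ℂ (Γ.embedding w) (Γ.embedding w)).re = ‖Γ.embedding w‖ ^ 2 :=
    inner_self_eq_norm_sq (𝕜 := ℂ) _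
  refine absurd hq (not_le.2 (mul_lt_of_re_inner_lt (x := Γ.formEmbedding R σ z)
    (y := Γ.formEmbedding R σ w) hnpos ht ?_ rfl ?_ ?_))
  · rw [inner_formEmbedding R hσ, hz', hww]
  · rw [inner_formEmbedding R hσ, Complex.add_re, hww]
  · rwa [inner_formEmbedding R hσ, hz', ← inner_conj_symm, Complex.conj_re, ← hz]

theorem eigenvalue_le_of_spectralSpace (R : Finset V) {σ σ' : ℝ} (hσ : 0 ≤ σ) (hσ' : 0 ≤ σ')
    (n : ℕ) {t : ℝ}
    (h : ∀ w ∈ spectralSpace (Γ.eigenLift R σ) (Γ.eigenvalue R σ n),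
      (Γ.robinForm R σ' w w).re ≤ t * ‖Γ.embedding w‖ ^ 2) : Γ.eigenvalue R σ' n ≤ t := by
  have hD := Γ.discreteSpectrum R hσ
  have hfin := hD.finite (Γ.eigenvalue R σ n)
  let e := Γ.spectralSpaceEquiv R σ (Γ.eigenvalue R σ n)
  have : FiniteDimensional ℂ (spectralSpace (Γ.eigenLift R σ) (Γ.eigenvalue R σ n)) :=
    Module.Finite.equiv e.symm
  refine eigenvalue_le_of_form_le R hσ' _ ?_ h
  rw [e.finrank_eq]
  exact hD.lt_finrank_orderedEigenvalue n

theorem eigenvalue_nonneg (R : Finset V) {σ : ℝ} (hσ : 0 ≤ σ) (n : ℕ) :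
    0 ≤ Γ.eigenvalue R σ n :=
  (Γ.discreteSpectrum R hσ).orderedEigenvalue_nonneg n

theorem eigenvalue_mono (R : Finset V) {σ σ' : ℝ} (hσ : 0 ≤ σ) (h : σ ≤ σ') (n : ℕ) :
    Γ.eigenvalue R σ n ≤ Γ.eigenvalue R σ' n := by
  refine eigenvalue_le_of_spectralSpace R (hσ.trans h) hσ n fun w hw => ?_
  refine le_trans ?_ (re_robinForm_le R σ' hw)
  rw [re_robinForm, re_robinForm]
  have := mul_le_mul_of_nonneg_right h (boundaryForm_nonneg R w)
  linarith

/-- The trace inequality alone gives a constant growing with the eigenvalue; the bound serves only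
to make each `λ_n` continuous. -/
theorem exists_eigenvalue_le_add_mul (Γ : MetricGraph V E) (R : Finset V) :
    ∃ K : ℝ, 0 ≤ K ∧ ∀ (n : ℕ) (σ σ' : ℝ), 0 ≤ σ → σ ≤ σ' →
      Γ.eigenvalue R σ' n ≤ Γ.eigenvalue R σ n + K * (1 + Γ.eigenvalue R σ n) * (σ' - σ) := by
  obtain ⟨K, hK, hle⟩ := Γ.exists_boundaryForm_le R
  refine ⟨K, hK, fun n σ σ' hσ h => ?_⟩
  refine eigenvalue_le_of_spectralSpace R hσ (hσ.trans h) n fun w hw => ?_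
  have h1 := re_robinForm_le R σ hw
  have h2 := norm_derivative_sq_le R hσ h1
  have h3 : Γ.boundaryForm R w ≤ K * ((1 + Γ.eigenvalue R σ n) * ‖Γ.embedding w‖ ^ 2) :=
    (hle w).trans (by gcongr; linarith)
  rw [re_robinForm] at h1 ⊢
  nlinarith [mul_le_mul_of_nonneg_right h3 (sub_nonneg.2 h)]

theorem exists_eigenvalue_add_le (Γ : MetricGraph V E) (R : Finset V) :
    ∃ C : ℝ, 0 ≤ C ∧ ∀ (n : ℕ) (σ : ℝ), 0 ≤ σ → ∃ δ > 0, ∀ h, 0 ≤ h → h ≤ δ →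
      Γ.eigenvalue R (σ + h) n ≤ Γ.eigenvalue R σ n + C * h := by
  obtain ⟨C, hC, hCle⟩ := Γ.exists_boundaryForm_le_of_mem_eigenLift R
  obtain ⟨K, hK, hKle⟩ := Γ.exists_boundaryForm_le R
  refine ⟨2 * C, by positivity, fun n σ hσ => ?_⟩
  have hD := Γ.discreteSpectrum R hσ
  set t := Γ.eigenvalue R σ n with ht
  have ht0 : 0 ≤ t := eigenvalue_nonneg R hσ n
  obtain ⟨ε, hε, hgap⟩ := hD.exists_gap t
  have hlift : ∀ μ : ℝ, t - ε < μ → μ < t → Γ.eigenLift R σ μ = ⊥ := by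
    intro μ h1 h2
    have h3 := hgap μ (by rw [abs_of_neg (by linarith)]; linarith) h2.ne
    rw [← map_eigenLift] at h3
    refine eq_bot_iff.2 fun w hw => eq_zero_of_embedding_eq_zero ?_
    have h4 := Submodule.mem_map_of_mem (f := (Γ.embedding : Γ.formDomain →ₗ[ℂ] Γ.L2)) hw
    rw [h3] at h4
    exact (Submodule.mem_bot ℂ).1 h4
  -- For such `h` the boundary term of the lower part stays within the gap `ε`; the `+ 1` keeps the
  -- denominator positive.
  refine ⟨ε / (2 * K * (1 + t) + 1), by positivity, fun h h0 hδ => ?_⟩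
  have hh : 2 * h * (K * (1 + t)) ≤ ε := by
    rw [le_div_iff₀ (by positivity)] at hδ
    nlinarith
  refine eigenvalue_le_of_spectralSpace R hσ (by linarith) n fun w hw => ?_
  rw [← ht, DiscreteSpectrum.spectralSpace_eq_sup (show t - ε ≤ t by linarith) hlift] at hw
  obtain ⟨x, hx, y, hy, rfl⟩ := Submodule.mem_sup.1 hw
  have horth := inner_eq_zero_of_mem R σ (show t - ε < t by linarith) hx hy
  have hcross : Γ.robinForm R σ y x = 0 := by rw [hy x, horth, mul_zero]
  have hcross' : Γ.robinForm R σ x y = 0 := by rw [robinForm_conj R σ y x, hcross, map_zero]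
  have hq : (Γ.robinForm R σ (x + y) (x + y)).re
      = (Γ.robinForm R σ x x).re + (Γ.robinForm R σ y y).re := by
    simp only [map_add, LinearMap.add_apply, hcross, hcross', add_zero, zero_add, Complex.add_re]
  have hnorm : ‖Γ.embedding (x + y)‖ ^ 2 = ‖Γ.embedding x‖ ^ 2 + ‖Γ.embedding y‖ ^ 2 := by
    rw [map_add]
    have h1 : inner ℂ (Γ.embedding x) (Γ.embedding y) = 0 := inner_eq_zero_symm.1 horth
    have h2 := norm_add_sq_eq_norm_sq_add_norm_sq_of_inner_eq_zero (𝕜 := ℂ)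
      (Γ.embedding x) (Γ.embedding y) h1
    nlinarith
  have hx1 := re_robinForm_le R σ hx
  have hy1 := re_robinForm_of_mem R hy
  have hBx : Γ.boundaryForm R x ≤ K * (1 + t) * ‖Γ.embedding x‖ ^ 2 := by
    have h2 := norm_derivative_sq_le R hσ hx1
    refine (hKle x).trans ?_
    rw [mul_assoc]
    gcongr
    nlinarith [sq_nonneg ‖Γ.embedding x‖]
  have hBy := hCle σ t hσ ht0 y hy
  have hB := boundaryForm_add_le R x y
  have hsplit : (Γ.robinForm R (σ + h) (x + y) (x + y)).re
      = (Γ.robinForm R σ (x + y) (x + y)).re + h * Γ.boundaryForm R (x + y) := by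
    rw [re_robinForm, re_robinForm]; ring
  rw [hsplit, hq, hnorm]
  exact perturbed_form_le h0 hC (sq_nonneg _) hh hB hBx hBy hx1 hy1

theorem exists_lipschitz_eigenvalue (Γ : MetricGraph V E) (R : Finset V) :
    ∃ C : ℝ, 0 ≤ C ∧ ∀ (n : ℕ) (σ₁ σ₂ : ℝ), 0 ≤ σ₁ → 0 ≤ σ₂ →
      |Γ.eigenvalue R σ₁ n - Γ.eigenvalue R σ₂ n| ≤ C * |σ₁ - σ₂| := by
  obtain ⟨C, hC, hloc⟩ := Γ.exists_eigenvalue_add_le R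
  obtain ⟨K, hK, hcont⟩ := Γ.exists_eigenvalue_le_add_mul R
  refine ⟨C, hC, fun n σ₁ σ₂ h₁ h₂ => ?_⟩
  wlog h : σ₁ ≤ σ₂ generalizing σ₁ σ₂
  · rw [abs_sub_comm, abs_sub_comm σ₁]
    exact this σ₂ σ₁ h₂ h₁ (not_le.1 h).le
  have hmono := eigenvalue_mono (Γ := Γ) R h₁ h n
  rw [abs_of_nonpos (by linarith), abs_of_nonpos (by linarith)]
  set f : ℝ → ℝ := fun σ => Γ.eigenvalue R σ n with hf
  have hL0 : 0 ≤ K * (1 + f σ₂) := by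
    have := eigenvalue_nonneg (Γ := Γ) R h₂ n
    positivity
  have hlip : ∀ x ∈ Icc σ₁ σ₂, ∀ y ∈ Icc σ₁ σ₂, x ≤ y →
      |f y - f x| ≤ K * (1 + f σ₂) * |y - x| := by
    intro x hx y hy hxy
    have e1 := eigenvalue_mono (Γ := Γ) R (h₁.trans hx.1) hxy n
    have e2 := hcont n x y (h₁.trans hx.1) hxy
    have e3 := eigenvalue_mono (Γ := Γ) R (h₁.trans hx.1) hx.2 n
    rw [abs_of_nonneg (sub_nonneg.2 e1), abs_of_nonneg (sub_nonneg.2 hxy)]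
    have e4 : K * (1 + f x) * (y - x) ≤ K * (1 + f σ₂) * (y - x) :=
      mul_le_mul_of_nonneg_right (mul_le_mul_of_nonneg_left (by simp only [hf]; linarith) hK)
        (sub_nonneg.2 hxy)
    simp only [hf] at e4 ⊢
    linarith
  have hfc : ContinuousOn f (Icc σ₁ σ₂) := by
    refine LipschitzOnWith.continuousOn (K := (K * (1 + f σ₂)).toNNReal) ?_
    refine LipschitzOnWith.of_dist_le_mul fun x hx y hy => ?_
    rw [Real.coe_toNNReal _ hL0, Real.dist_eq, Real.dist_eq]
    rcases le_total x y with hxy | hxy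
    · rw [abs_sub_comm, abs_sub_comm x]
      exact hlip x hx y hy hxy
    · exact hlip y hy x hx hxy
  -- The step size `δ` depends on the point, but the right slopes are at most `C` everywhere; for a
  -- continuous function this bounds its growth over the whole interval.
  have key := image_le_of_liminf_slope_right_le_deriv_boundary (f := f) (a := σ₁) (b := σ₂) hfc
    (B := fun x => f σ₁ + C * (x - σ₁)) (B' := fun _ => C) (by simp) (by fun_prop)
    (fun x _ => by
      have h1 := (((hasDerivAt_id x).sub_const σ₁).const_mul C).const_add (f σ₁)
      rw [mul_one] at h1
      exact h1.hasDerivWithinAt)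
    (fun x hx r hr => by
      obtain ⟨δ, hδ, hle⟩ := hloc n x (h₁.trans hx.1)
      refine Eventually.frequently ?_
      filter_upwards [Ioc_mem_nhdsGT (show x < x + δ by linarith)] with z hz
      have h1 := hle (z - x) (by linarith [hz.1]) (by linarith [hz.2])
      rw [add_sub_cancel] at h1
      have hzx : 0 < z - x := by linarith [hz.1]
      refine lt_of_le_of_lt ?_ hr
      rw [slope_def_field, div_le_iff₀ hzx]
      simp only [hf]
      linarith)
    (right_mem_Icc.2 h)
  simp only [hf] at key
  linarith

end MetricGraph

end

theorem theorem1p4 {V E : Type*} [Fintype V] [DecidableEq V] [Fintype E] [Nonempty E]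
    (Γ : MetricGraph V E) (R : Finset V) :
    (∀ σ : ℝ, 0 ≤ σ → Γ.IsEigenvalueSequence R σ (Γ.eigenvalue R σ)) ∧
    (∃ C : ℝ, ∀ n : ℕ, ∀ σ₁ σ₂ : ℝ, 0 ≤ σ₁ → 0 ≤ σ₂ →
      |Γ.gap R n σ₁ - Γ.gap R n σ₂| ≤ C * |σ₁ - σ₂|) ∧
    (∀ a b : ℝ, 0 ≤ a → a ≤ b →
      ∃ M : ℝ, ∀ n : ℕ, ∀ σ ∈ Set.Icc a b, |Γ.gap R n σ| ≤ M) := by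
  obtain ⟨C, hC, hlip⟩ := Γ.exists_lipschitz_eigenvalue R
  refine ⟨fun σ hσ => Γ.isEigenvalueSequence R hσ, ⟨C, fun n σ₁ σ₂ h₁ h₂ => ?_⟩,
    fun a b ha hab => ⟨C * b, fun n σ hσ => ?_⟩⟩
  -- The Neumann eigenvalue cancels in the difference of two gaps.
  · rw [MetricGraph.gap, MetricGraph.gap, sub_sub_sub_cancel_right]
    exact hlip n σ₁ σ₂ h₁ h₂
  · have h0 : 0 ≤ σ := ha.trans hσ.1
    have h1 := hlip n σ 0 h0 le_rfl
    rw [sub_zero, abs_of_nonneg h0] at h1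
    exact h1.trans (mul_le_mul_of_nonneg_left hσ.2 hC)
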